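/- Let $N\ge 1$, $0<\alpha<1$ and $\alpha<\beta\le 1$. Let $E\subset\mathbb{R}^N$ be a nonempty bounded open set, not assumed connected, with boundary of class $C^{2,\beta}$: near each point of $\partial E$, after a rigid motion, $E$ is the subgraph of a function of $N-1$ variables that is of class $C^2$ and whose second derivatives are Hölder continuous with exponent $\beta$. Put $\tau_E=1_E-1_{\mathbb{R}^N\setminus E}$ and, for $x\in\partial E$, let $$H_E(x)=-\lim_{\varepsilon\to 0^+}\int_{|y-x|\ge\varepsilon}\tau_E(y)\,|x-y|^{-(N+\alpha)}\,dy$$ be the nonlocal mean curvature of $\partial E$ at $x$ (the limit exists for such $E$). If $H_E$ is constant on $\partial E$, then $E$ is an open ball of positive radius. -/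

import Mathlib

open MeasureTheory Filter Topology
open scoped NNReal RealInnerProductSpace

noncomputable section

/-- `τ_E = 1_E - 1_{Eᶜ}`. -/
def tau {N : ℕ} (E : Set (EuclideanSpace ℝ (Fin N))) (y : EuclideanSpace ℝ (Fin N)) : ℝ :=
  E.indicator (fun _ => (1 : ℝ)) y - Eᶜ.indicator (fun _ => (1 : ℝ)) y

/-- The truncated integral `∫_{|y - x| ≥ ε} τ_E(y) |x - y|^{-(N + α)} dy`. -/
def truncatedIntegral {N : ℕ} (α : ℝ) (E : Set (EuclideanSpace ℝ (Fin N)))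
    (x : EuclideanSpace ℝ (Fin N)) (ε : ℝ) : ℝ :=
  ∫ y in {y : EuclideanSpace ℝ (Fin N) | ε ≤ ‖y - x‖},
    tau E y * ‖x - y‖ ^ (-((N : ℝ) + α))

/-- The nonlocal mean curvature
`H_E(x) = - lim_{ε → 0⁺} ∫_{|y - x| ≥ ε} τ_E(y) |x - y|^{-(N + α)} dy`. -/
def nonlocalMeanCurvature {N : ℕ} (α : ℝ) (E : Set (EuclideanSpace ℝ (Fin N)))
    (x : EuclideanSpace ℝ (Fin N)) : ℝ :=
  -limUnder (𝓝[>] (0 : ℝ)) (truncatedIntegral α E x)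

/-- `h` is of class `C^{2,β}` on the open set `s`: it is `C²` there and its second derivative
is Hölder continuous on `s` with exponent `β`. -/
def IsC2HolderOn {V : Type*} [NormedAddCommGroup V] [NormedSpace ℝ V]
    (β : ℝ≥0) (h : V → ℝ) (s : Set V) : Prop :=
  ContDiffOn ℝ 2 h s ∧ ∃ C : ℝ≥0, HolderOnWith C β (fderiv ℝ (fderiv ℝ h)) s

/-- `E` has `C^{2,β}` boundary: near each boundary point `x` there is a unit vector `ν` such that
`E` is the subgraph, in direction `ν`, of a `C^{2,β}` function of the remaining variables, that is,
of the orthogonal projection of `y - x` to the hyperplane `ν^⊥`. -/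
def HasC2HolderBoundary {N : ℕ} (β : ℝ≥0) (E : Set (EuclideanSpace ℝ (Fin N))) : Prop :=
  ∀ x ∈ frontier E, ∃ ν : EuclideanSpace ℝ (Fin N), ‖ν‖ = 1 ∧
    ∃ r : ℝ, 0 < r ∧ ∃ h : (Submodule.span ℝ {ν})ᗮ → ℝ,
      IsC2HolderOn β h (Metric.ball 0 r) ∧
      ∀ y ∈ Metric.ball x r,
        (y ∈ E ↔ ⟪y - x, ν⟫ < h ((Submodule.span ℝ {ν})ᗮ.orthogonalProjectionOnto (y - x)))

end

/-!
# Bounded open sets with constant nonlocal mean curvature are balls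

The proof is the method of moving planes. Fix a unit vector `e`. For heights `l` above a critical
value, the reflection `R` in the hyperplane `⟪y, e⟫ = l` maps the part of `E` beyond it into `E`
(`MidpointBound`, `exists_midpointBound`). At the critical height one of two things happens, and
both force `E` to be symmetric under `R` up to a null set.

* The reflected cap touches `∂E` at the mirror image of a boundary point `y` off the hyperplane
  (`ReflectsInto.ae_symm_of_touching`). The difference of the curvatures at `y` and `R y` is half
  the integral of the antisymmetric function `τ_E ∘ R - τ_E` against a kernel of the same sign; as
  it vanishes, so does `τ_E ∘ R - τ_E`.
* The direction `e` is tangent to `∂E` at a point `x₀` of the hyperplane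
  (`MidpointBound.tangent`, `ReflectsInto.ae_symm_of_tangent`). Here one differentiates the
  curvature at `x₀` in direction `e`, and the derivative is again an integral of `τ_E ∘ R - τ_E`
  against a function of the same sign.

The singular integrals are replaced by `potential α E ε`, with kernel `max |x - y| ε ^ (-(N + α))`,
which on `∂E` converges to `-H_E` as `ε → 0` (`tendsto_potential`). In the tangential case the full
derivative is never formed. The potential at a fixed scale `δ` is differentiable
(`exists_hasFDerivAt_potential`), and the contribution of the scales below `δ` changes along the
boundary at a rate `O(δ ^ (1 - α) + δ ^ (β - α))`, uniformly in `ε`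
(`LocalGraph.exists_near_estimate`). This last estimate is where `β > α` enters: one compares two
boundary points by a volume-preserving shear which slides the graph along itself, so that only
kernels are compared; the linear part of the shear contributes an even kernel, which sees only the
thin region between two tangent paraboloids, and the remainder gains a factor `|x - y| ^ β`.

Finally, almost everywhere symmetry places the barycentre of `E` on the critical hyperplane
(`inner_barycenter`). So the critical heights in all directions come from one point `b`, and then
every point of `E` at distance `ρ` from `b` forces the open ball of radius `ρ` around `b` into `E`
(`mem_of_midpointBound`).
-/

noncomputable section

/-! ### The regularised kernel -/

/-- Euclidean space `ℝ^N`. -/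
abbrev Euc (N : ℕ) : Type := EuclideanSpace ℝ (Fin N)

/-- The singular kernel `r ^ (-p)`, frozen at its value at `ε` for `r ≤ ε`. -/
def truncKernel (p ε r : ℝ) : ℝ := max r ε ^ (-p)

lemma truncKernel_nonneg {p ε r : ℝ} (hε : 0 < ε) : 0 ≤ truncKernel p ε r :=
  Real.rpow_nonneg (hε.le.trans (le_max_right _ _)) _

lemma truncKernel_le {p ε r : ℝ} (hp : 0 ≤ p) (hε : 0 < ε) : truncKernel p ε r ≤ ε ^ (-p) :=
  Real.rpow_le_rpow_of_nonpos hε (le_max_right _ _) (by linarith)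

lemma truncKernel_le_rpow {p ε r : ℝ} (hp : 0 ≤ p) (hr : 0 < r) :
    truncKernel p ε r ≤ r ^ (-p) :=
  Real.rpow_le_rpow_of_nonpos hr (le_max_left _ _) (by linarith)

lemma truncKernel_eq {p ε r : ℝ} (h : ε ≤ r) : truncKernel p ε r = r ^ (-p) := by
  rw [truncKernel, max_eq_left h]

lemma truncKernel_antitone {p ε r s : ℝ} (hp : 0 ≤ p) (hε : 0 < ε) (h : r ≤ s) :
    truncKernel p ε s ≤ truncKernel p ε r :=
  Real.rpow_le_rpow_of_nonpos (hε.trans_le (le_max_right _ _)) (max_le_max_right _ h)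
    (by linarith)

lemma continuous_truncKernel {p ε : ℝ} (hε : 0 < ε) : Continuous (truncKernel p ε) := by
  unfold truncKernel
  refine (continuous_id.max continuous_const).rpow_const fun x => Or.inl ?_
  exact (hε.trans_le (le_max_right _ _)).ne'

lemma tendsto_truncKernel {p r : ℝ} (hr : 0 < r) :
    Tendsto (fun ε => truncKernel p ε r) (𝓝[>] 0) (𝓝 (r ^ (-p))) := by
  refine tendsto_const_nhds.congr' ?_
  filter_upwards [Ioo_mem_nhdsGT hr] with ε hε
  exact (truncKernel_eq hε.2.le).symm

/-- Mean value bound for the power function on `[a, ∞)`. -/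
lemma abs_rpow_neg_sub_le {p a r s : ℝ} (hp : 0 ≤ p) (ha : 0 < a) (hr : a ≤ r) (hs : a ≤ s) :
    |r ^ (-p) - s ^ (-p)| ≤ p * a ^ (-p - 1) * |r - s| := by
  have := (convex_Ici a).norm_image_sub_le_of_norm_hasDerivWithin_le
    (f := fun x : ℝ => x ^ (-p)) (f' := fun x => -p * x ^ (-p - 1)) (C := p * a ^ (-p - 1))
    (x := s) (y := r) (fun x hx => ?_) (fun x hx => ?_) hs hr
  · simpa using this
  · exact (Real.hasDerivAt_rpow_const (Or.inl (ha.trans_le hx).ne')).hasDerivWithinAt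
  · have hx0 : 0 < x := ha.trans_le hx
    rw [norm_mul, norm_neg, Real.norm_of_nonneg hp,
      Real.norm_of_nonneg (Real.rpow_nonneg hx0.le _)]
    exact mul_le_mul_of_nonneg_left (Real.rpow_le_rpow_of_nonpos ha hx (by linarith)) hp

lemma abs_truncKernel_sub_le {p ε a r s : ℝ} (hp : 0 ≤ p) (ha : 0 < a) (hr : a ≤ max r ε)
    (hs : a ≤ max s ε) :
    |truncKernel p ε r - truncKernel p ε s| ≤ p * a ^ (-p - 1) * |r - s| := by
  refine (abs_rpow_neg_sub_le hp ha hr hs).trans ?_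
  have := abs_max_sub_max_le_abs r s ε
  gcongr

/-- The part of the kernel living at scales below `δ`. -/
def nearKernel (p ε δ r : ℝ) : ℝ := truncKernel p ε r - truncKernel p δ r

lemma nearKernel_eq_zero {p ε δ r : ℝ} (h : ε ≤ δ) (hr : δ ≤ r) : nearKernel p ε δ r = 0 := by
  rw [nearKernel, truncKernel_eq hr, truncKernel_eq (h.trans hr), sub_self]

lemma abs_nearKernel_sub_le {p ε δ a r s : ℝ} (hp : 0 ≤ p) (ha : 0 < a) (hr : a ≤ r)
    (hs : a ≤ s) :
    |nearKernel p ε δ r - nearKernel p ε δ s| ≤ 2 * p * a ^ (-p - 1) * |r - s| := by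
  have h1 := abs_truncKernel_sub_le (ε := ε) hp ha (le_max_of_le_left hr) (le_max_of_le_left hs)
  have h2 := abs_truncKernel_sub_le (ε := δ) hp ha (le_max_of_le_left hr) (le_max_of_le_left hs)
  have : nearKernel p ε δ r - nearKernel p ε δ s =
    (truncKernel p ε r - truncKernel p ε s) - (truncKernel p δ r - truncKernel p δ s) := by
    unfold nearKernel; ring
  rw [this]
  refine (abs_sub _ _).trans ?_
  linarith

lemma continuous_nearKernel {p ε δ : ℝ} (hε : 0 < ε) (hδ : 0 < δ) :
    Continuous (nearKernel p ε δ) :=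
  (continuous_truncKernel hε).sub (continuous_truncKernel hδ)

lemma integrable_truncKernel_norm {N : ℕ} {p ε : ℝ} (hp : (N : ℝ) < p) (hε : 0 < ε) :
    Integrable (fun z : Euc N => truncKernel p ε ‖z‖) := by
  have hp0 : 0 ≤ p := (Nat.cast_nonneg N).trans hp.le
  have h := (integrable_one_add_norm (E := Euc N) (μ := volume) (r := p)
    (by simpa using hp)).const_mul ((min ε 1 / 2) ^ (-p))
  refine h.mono' ((continuous_truncKernel hε).comp continuous_norm).aestronglyMeasurable
    (Eventually.of_forall fun z => ?_)
  have hm : 0 < min ε 1 := lt_min hε one_pos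
  rw [Real.norm_of_nonneg (truncKernel_nonneg hε), ← Real.mul_rpow (by positivity) (by positivity)]
  refine Real.rpow_le_rpow_of_nonpos (by positivity) ?_ (by linarith)
  have h1 : min ε 1 ≤ ε := min_le_left _ _
  have h2 : min ε 1 ≤ 1 := min_le_right _ _
  have h3 : ε ≤ max ‖z‖ ε := le_max_right _ _
  have h4 : ‖z‖ ≤ max ‖z‖ ε := le_max_left _ _
  have : min ε 1 * ‖z‖ ≤ ‖z‖ := mul_le_of_le_one_left (norm_nonneg z) h2
  linarith

lemma integrable_truncKernel_sub {N : ℕ} {p ε : ℝ} (hp : (N : ℝ) < p) (hε : 0 < ε) (x : Euc N) :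
    Integrable (fun y : Euc N => truncKernel p ε ‖x - y‖) :=
  (integrable_truncKernel_norm hp hε).comp_sub_left x

/-! ### Volume estimates -/

/-- A set whose trace on small balls of radius `r` has volume `O(r ^ q)` sees the singularity
`‖z‖ ^ (-p)`, `p < q`, as an integrable one. The proof is a dyadic decomposition. -/
lemma lintegral_rpow_norm_le {N : ℕ} {p q : ℝ} (hp : 0 < p) (hpq : p < q) :
    ∃ K : ℝ, 0 ≤ K ∧ ∀ (s : Set (Euc N)) (C δ : ℝ), MeasurableSet s → 0 ≤ C → 0 < δ →
      (∀ r, 0 < r → r ≤ δ → volume (s ∩ Metric.closedBall 0 r) ≤ ENNReal.ofReal (C * r ^ q)) →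
      ∫⁻ z in s ∩ Metric.closedBall 0 δ, ENNReal.ofReal (‖z‖ ^ (-p)) ≤
        ENNReal.ofReal (C * K * δ ^ (q - p)) := by
  set θ : ℝ := (1 / 2 : ℝ) ^ (q - p) with hθ
  have hθ0 : 0 ≤ θ := by positivity
  have hθ1 : θ < 1 := Real.rpow_lt_one (by norm_num) (by norm_num) (by linarith)
  refine ⟨(1 / 2 : ℝ) ^ (-p) * (1 - θ)⁻¹, mul_nonneg (by positivity)
    (inv_nonneg.2 (by linarith)), fun s C δ hs hC hδ hvol => ?_⟩
  set rad : ℕ → ℝ := fun k => (1 / 2 : ℝ) ^ k * δ with hrad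
  have hrad0 : ∀ k, 0 < rad k := fun k => by positivity
  have hradδ : ∀ k, rad k ≤ δ := fun k =>
    mul_le_of_le_one_left hδ.le (pow_le_one₀ (by norm_num) (by norm_num))
  set w : ℕ → ℝ := fun k => (1 / 2 * rad k) ^ (-p) with hw
  set B : ℕ → Set (Euc N) := fun k => s ∩ Metric.closedBall 0 (rad k) with hB
  have hBm : ∀ k, MeasurableSet (B k) := fun k => hs.inter Metric.isClosed_closedBall.measurableSet
  have hpt : ∀ z ∈ s ∩ Metric.closedBall (0 : Euc N) δ, ENNReal.ofReal (‖z‖ ^ (-p)) ≤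
      ∑' k, (B k).indicator (fun _ => ENNReal.ofReal (w k)) z := by
    rintro z ⟨hzs, hzδ⟩
    rw [mem_closedBall_zero_iff] at hzδ
    rcases eq_or_ne z 0 with rfl | hz
    · simp [Real.zero_rpow (neg_ne_zero.2 hp.ne')]
    have hz0 : 0 < ‖z‖ := norm_pos_iff.2 hz
    obtain ⟨k, hk1, hk2⟩ := exists_nat_pow_near_of_lt_one (x := ‖z‖ / δ) (y := (1 / 2 : ℝ))
      (by positivity) ((div_le_one hδ).2 hzδ) (by norm_num) (by norm_num)
    rw [lt_div_iff₀ hδ] at hk1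
    rw [div_le_iff₀ hδ] at hk2
    refine le_trans ?_ (ENNReal.le_tsum k)
    have hzB : z ∈ B k := ⟨hzs, mem_closedBall_zero_iff.2 hk2⟩
    rw [Set.indicator_of_mem hzB]
    refine ENNReal.ofReal_le_ofReal (Real.rpow_le_rpow_of_nonpos ?_ ?_ (by linarith))
    · have := hrad0 k; positivity
    · have : 1 / 2 * rad k = (1 / 2) ^ (k + 1) * δ := by rw [hrad]; ring
      rw [this]; exact hk1.le
  have hterm : ∀ k, w k * (C * rad k ^ q) =
      C * (1 / 2 : ℝ) ^ (-p) * δ ^ (q - p) * θ ^ k := by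
    intro k
    have h1 : w k = (1 / 2 : ℝ) ^ (-p) * rad k ^ (-p) :=
      Real.mul_rpow (by norm_num) (hrad0 k).le
    have h2 : rad k ^ (-p) * rad k ^ q = rad k ^ (q - p) := by
      rw [← Real.rpow_add (hrad0 k)]; congr 1; ring
    have h3 : rad k ^ (q - p) = θ ^ k * δ ^ (q - p) := by
      rw [hrad, Real.mul_rpow (by positivity) hδ.le, hθ, ← Real.rpow_natCast, ← Real.rpow_natCast,
        ← Real.rpow_mul (by norm_num), ← Real.rpow_mul (by norm_num), mul_comm (k : ℝ)]
    calc w k * (C * rad k ^ q) = C * (1 / 2 : ℝ) ^ (-p) * (rad k ^ (-p) * rad k ^ q) := by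
          rw [h1]; ring
      _ = _ := by rw [h2, h3]; ring
  calc ∫⁻ z in s ∩ Metric.closedBall 0 δ, ENNReal.ofReal (‖z‖ ^ (-p))
      ≤ ∫⁻ z in s ∩ Metric.closedBall 0 δ,
          ∑' k, (B k).indicator (fun _ => ENNReal.ofReal (w k)) z :=
        setLIntegral_mono' (hs.inter Metric.isClosed_closedBall.measurableSet) hpt
    _ ≤ ∫⁻ z, ∑' k, (B k).indicator (fun _ => ENNReal.ofReal (w k)) z :=
        setLIntegral_le_lintegral _ _
    _ = ∑' k, ENNReal.ofReal (w k) * volume (B k) := by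
        rw [lintegral_tsum fun k => (measurable_const.indicator (hBm k)).aemeasurable]
        exact tsum_congr fun k => lintegral_indicator_const (hBm k) _
    _ ≤ ∑' k, ENNReal.ofReal (w k * (C * rad k ^ q)) := by
        refine ENNReal.tsum_le_tsum fun k => ?_
        rw [ENNReal.ofReal_mul (Real.rpow_nonneg (by have := hrad0 k; positivity) _)]
        gcongr
        exact hvol _ (hrad0 k) (hradδ k)
    _ = ENNReal.ofReal (∑' k, C * (1 / 2 : ℝ) ^ (-p) * δ ^ (q - p) * θ ^ k) := by
        rw [ENNReal.ofReal_tsum_of_nonneg]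
        · simp_rw [hterm]
        · intro k; positivity
        · exact (summable_geometric_of_lt_one hθ0 hθ1).mul_left _
    _ = _ := by
        rw [tsum_mul_left, tsum_geometric_of_lt_one hθ0 hθ1]
        congr 1; ring

/-- The volume of the part of a slab `|ℓ| ≤ a` in a ball: averaging over the translations `s • ν`
with `0 ≤ s ≤ r`, each point is covered for a set of `s` of length at most `2 a`. -/
lemma volume_slab_le {N : ℕ} (ℓ : Euc N →L[ℝ] ℝ) {ν : Euc N} (hν : ‖ν‖ = 1) (hℓ : ℓ ν = 1)
    {a r : ℝ} (hr : 0 < r) :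
    volume {z : Euc N | ‖z‖ ≤ r ∧ |ℓ z| ≤ a} ≤
      ENNReal.ofReal (2 * a / r) * volume (Metric.closedBall (0 : Euc N) (2 * r)) := by
  set S : Set (Euc N) := {z | ‖z‖ ≤ r ∧ |ℓ z| ≤ a} with hS
  have hSm : MeasurableSet S :=
    ((isClosed_le continuous_norm continuous_const).inter
      (isClosed_le ℓ.continuous.abs continuous_const)).measurableSet
  have key : ENNReal.ofReal r * volume S ≤
      ENNReal.ofReal (2 * a) * volume (Metric.closedBall (0 : Euc N) (2 * r)) := by
    have hmeas : Measurable (Function.uncurry fun (s : ℝ) (y : Euc N) =>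
        S.indicator (fun _ => (1 : ENNReal)) (y + s • ν)) := by
      refine (measurable_const.indicator hSm).comp ?_
      exact (continuous_snd.add (continuous_fst.smul continuous_const)).measurable
    calc ENNReal.ofReal r * volume S
        = ∫⁻ _ in Set.Icc (-r) 0, volume S := by
          rw [setLIntegral_const, Real.volume_Icc, mul_comm]; simp
      _ = ∫⁻ s in Set.Icc (-r) 0, ∫⁻ y : Euc N,
            S.indicator (fun _ => (1 : ENNReal)) (y + s • ν) := by
          refine lintegral_congr fun s => ?_
          rw [lintegral_add_right_eq_self (S.indicator fun _ => (1 : ENNReal)) (s • ν),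
            lintegral_indicator_const hSm, one_mul]
      _ = ∫⁻ y : Euc N, ∫⁻ s in Set.Icc (-r) 0,
            S.indicator (fun _ => (1 : ENNReal)) (y + s • ν) :=
          lintegral_lintegral_swap hmeas.aemeasurable
      _ ≤ ∫⁻ y : Euc N, (Metric.closedBall (0 : Euc N) (2 * r)).indicator
            (fun _ => ENNReal.ofReal (2 * a)) y := by
          refine lintegral_mono fun y => ?_
          by_cases hy : y ∈ Metric.closedBall (0 : Euc N) (2 * r)
          · rw [Set.indicator_of_mem hy]
            refine (setLIntegral_le_lintegral _ _).trans ?_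
            have hle : ∀ s : ℝ, S.indicator (fun _ => (1 : ENNReal)) (y + s • ν) ≤
                (Set.Icc (-a - ℓ y) (a - ℓ y)).indicator (fun _ => 1) s := by
              intro s
              by_cases hs : y + s • ν ∈ S
              · have h := hs.2
                rw [map_add, map_smul, hℓ, smul_eq_mul, mul_one, abs_le] at h
                rw [Set.indicator_of_mem hs, Set.indicator_of_mem]
                exact ⟨by linarith [h.1], by linarith [h.2]⟩
              · rw [Set.indicator_of_notMem hs]
                exact zero_le
            refine (lintegral_mono hle).trans ?_
            rw [lintegral_indicator_const measurableSet_Icc, one_mul, Real.volume_Icc]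
            exact ENNReal.ofReal_le_ofReal (by linarith)
          · rw [Set.indicator_of_notMem hy, nonpos_iff_eq_zero]
            refine (setLIntegral_eq_zero_iff' measurableSet_Icc ?_).2 ?_
            · exact (hmeas.comp (measurable_id.prodMk measurable_const)).aemeasurable
            · refine Eventually.of_forall fun s hs => ?_
              refine Set.indicator_of_notMem (fun h => hy ?_) _
              rw [mem_closedBall_zero_iff]
              have h1 : ‖s • ν‖ ≤ r := by
                rw [norm_smul, hν, mul_one, Real.norm_eq_abs, abs_le]
                exact ⟨by linarith [hs.1], by linarith [hs.2]⟩
              have h2 : ‖y‖ ≤ ‖y + s • ν‖ + ‖s • ν‖ := by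
                simpa using norm_sub_le (y + s • ν) (s • ν)
              linarith [h.1]
      _ = _ := lintegral_indicator_const Metric.isClosed_closedBall.measurableSet _
  rw [ENNReal.ofReal_div_of_pos hr, ← ENNReal.mul_div_right_comm,
    ENNReal.le_div_iff_mul_le (Or.inl (by simpa using hr)) (Or.inl ENNReal.ofReal_ne_top),
    mul_comm]
  exact key

/-- The singularity `‖z‖ ^ (-(N + α))` is integrable on the region `|ℓ z| ≤ C ‖z‖²` between two
tangent paraboloids, because that region has volume `O(r ^ (N + 1))` in the ball of radius `r`. -/
lemma lintegral_paraboloid_le (N : ℕ) {α : ℝ} (hα₀ : 0 < α) (hα₁ : α < 1) :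
    ∃ K : ℝ, 0 ≤ K ∧ ∀ (ℓ : Euc N →L[ℝ] ℝ) (ν : Euc N) (C δ : ℝ), ‖ν‖ = 1 → ℓ ν = 1 → 0 ≤ C →
      0 < δ →
      ∫⁻ z in {z : Euc N | |ℓ z| ≤ C * ‖z‖ ^ 2} ∩ Metric.closedBall 0 δ,
        ENNReal.ofReal (‖z‖ ^ (-((N : ℝ) + α))) ≤ ENNReal.ofReal (C * K * δ ^ (1 - α)) := by
  obtain ⟨K, hK, H⟩ := lintegral_rpow_norm_le (N := N) (p := N + α) (q := N + 1)
    (by positivity) (by linarith)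
  set κ : ℝ := (volume (Metric.ball (0 : Euc N) 1)).toReal with hκ
  have hκ0 : 0 ≤ κ := ENNReal.toReal_nonneg
  refine ⟨2 * 2 ^ N * κ * K, by positivity, fun ℓ ν C δ hν hℓ hC hδ => ?_⟩
  have hm : MeasurableSet {z : Euc N | |ℓ z| ≤ C * ‖z‖ ^ 2} :=
    (isClosed_le ℓ.continuous.abs (by fun_prop)).measurableSet
  refine (H _ (C * (2 * 2 ^ N * κ)) δ hm (by positivity) hδ fun r hr _ => ?_).trans_eq ?_
  · have hsub : {z : Euc N | |ℓ z| ≤ C * ‖z‖ ^ 2} ∩ Metric.closedBall 0 r ⊆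
        {z : Euc N | ‖z‖ ≤ r ∧ |ℓ z| ≤ C * r ^ 2} := by
      rintro z ⟨hz, hzr⟩
      rw [mem_closedBall_zero_iff] at hzr
      refine ⟨hzr, le_trans hz ?_⟩
      gcongr
    refine (measure_mono hsub).trans ((volume_slab_le ℓ hν hℓ hr).trans_eq ?_)
    rw [Measure.addHaar_closedBall _ _ (by positivity),
      ← ENNReal.ofReal_toReal (measure_ball_lt_top (μ := volume) (x := (0 : Euc N)) (r := 1)).ne,
      ← hκ, ← ENNReal.ofReal_mul (by positivity), ← ENNReal.ofReal_mul (by positivity)]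
    congr 1
    rw [Real.rpow_add_one hr.ne', Real.rpow_natCast]
    simp only [finrank_euclideanSpace, Fintype.card_fin]
    rw [mul_pow]
    field_simp
  · congr 1
    rw [show (N : ℝ) + 1 - (N + α) = 1 - α by ring]
    ring

lemma lintegral_closedBall_le {N : ℕ} (hN : 1 ≤ N) {γ : ℝ} (hγ₀ : 0 < γ) (hγ₁ : γ < 1) :
    ∃ K : ℝ, 0 ≤ K ∧ ∀ δ : ℝ, 0 < δ →
      ∫⁻ z in Metric.closedBall (0 : Euc N) δ, ENNReal.ofReal (‖z‖ ^ (-((N : ℝ) - γ))) ≤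
        ENNReal.ofReal (K * δ ^ γ) := by
  have hN' : (1 : ℝ) ≤ N := by exact_mod_cast hN
  obtain ⟨K, hK, H⟩ := lintegral_rpow_norm_le (N := N) (p := N - γ) (q := N)
    (by linarith) (by linarith)
  set κ : ℝ := (volume (Metric.ball (0 : Euc N) 1)).toReal with hκ
  have hκ0 : 0 ≤ κ := ENNReal.toReal_nonneg
  refine ⟨κ * K, by positivity, fun δ hδ => ?_⟩
  have := H Set.univ κ δ MeasurableSet.univ hκ0 hδ fun r hr _ => ?_
  · rw [Set.univ_inter] at this
    refine this.trans_eq ?_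
    rw [show (N : ℝ) - (N - γ) = γ by ring]
  · rw [Set.univ_inter, Measure.addHaar_closedBall _ _ hr.le,
      ← ENNReal.ofReal_toReal (measure_ball_lt_top (μ := volume) (x := (0 : Euc N)) (r := 1)).ne,
      ← hκ, ← ENNReal.ofReal_mul (by positivity), Real.rpow_natCast]
    simp [mul_comm]

/-! ### Shears and reflections preserve volume -/

/-- A shear in direction `ν` preserves volume even if the displacement `g` is only measurable.
Weighting with the indicator of `0 ≤ ⟪y, ν⟫ + s ≤ 1`, whose integral over `s` is `1`, and
exchanging the integrals turns the shear into a translation of the line. -/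
lemma measurePreserving_shear {N : ℕ} {ν : Euc N} (hν : ‖ν‖ = 1) {g : Euc N → ℝ}
    (hg : Measurable g) (hinv : ∀ y (s : ℝ), g (y + s • ν) = g y) :
    MeasurePreserving (fun y : Euc N => y + g y • ν) := by
  have key : ∀ (G : Euc N → ENNReal), Measurable G → ∀ g : Euc N → ℝ, Measurable g →
      (∀ y (s : ℝ), g (y + s • ν) = g y) → ∫⁻ y, G (y + g y • ν) =
        ∫⁻ y, (Set.Icc (0 : ℝ) 1).indicator (fun _ => 1) ⟪y, ν⟫ * ∫⁻ u : ℝ, G (y + u • ν) := by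
    intro G hG g hg hinv
    set φ : ℝ → ENNReal := (Set.Icc (0 : ℝ) 1).indicator (fun _ => 1) with hφ
    have hφm : Measurable φ := measurable_const.indicator measurableSet_Icc
    have hφ1 : ∀ c : ℝ, ∫⁻ s : ℝ, φ (c + s) = 1 := by
      intro c
      rw [lintegral_add_left_eq_self φ c, hφ, lintegral_indicator_const measurableSet_Icc]
      simp
    have hin : Measurable fun y : Euc N => ⟪y, ν⟫ :=
      (continuous_id.inner continuous_const).measurable
    calc ∫⁻ y, G (y + g y • ν)
        = ∫⁻ y, ∫⁻ s : ℝ, φ (⟪y, ν⟫ + s) * G (y + g y • ν) := by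
          refine lintegral_congr fun y => ?_
          have hm : Measurable fun s : ℝ => φ (⟪y, ν⟫ + s) :=
            hφm.comp (measurable_const.add measurable_id)
          rw [lintegral_mul_const _ hm, hφ1, one_mul]
      _ = ∫⁻ s : ℝ, ∫⁻ y, φ (⟪y, ν⟫ + s) * G (y + g y • ν) := by
          refine lintegral_lintegral_swap (Measurable.aemeasurable ?_)
          refine (hφm.comp ((hin.comp measurable_fst).add measurable_snd)).mul (hG.comp ?_)
          exact measurable_fst.add ((hg.comp measurable_fst).smul_const ν)
      _ = ∫⁻ s : ℝ, ∫⁻ y, φ ⟪y, ν⟫ * G (y + (g y - s) • ν) := by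
          refine lintegral_congr fun s => ?_
          rw [← lintegral_add_right_eq_self _ ((-s) • ν)]
          refine lintegral_congr fun y => ?_
          have h1 : ⟪y + (-s) • ν, ν⟫ + s = ⟪y, ν⟫ := by
            rw [inner_add_left, inner_smul_left, real_inner_self_eq_norm_sq, hν]
            simp
          have h2 : y + (-s) • ν + g (y + (-s) • ν) • ν = y + (g y - s) • ν := by
            rw [hinv]; module
          rw [h1, h2]
      _ = ∫⁻ y, ∫⁻ s : ℝ, φ ⟪y, ν⟫ * G (y + (g y - s) • ν) := by
          refine (lintegral_lintegral_swap (Measurable.aemeasurable ?_)).symm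
          refine (hφm.comp (hin.comp measurable_fst)).mul (hG.comp ?_)
          exact measurable_fst.add
            (((hg.comp measurable_fst).sub measurable_snd).smul_const ν)
      _ = _ := by
          refine lintegral_congr fun y => ?_
          have hm : Measurable fun u : ℝ => G (y + u • ν) :=
            hG.comp (measurable_const.add (measurable_id.smul_const ν))
          have hm' : Measurable fun s : ℝ => G (y + (g y - s) • ν) :=
            hm.comp (measurable_const.sub measurable_id)
          rw [lintegral_const_mul _ hm',
            lintegral_sub_left_eq_self (fun u : ℝ => G (y + u • ν)) (g y)]
  have hT : Measurable fun y : Euc N => y + g y • ν := measurable_id.add (hg.smul_const ν)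
  refine ⟨hT, Measure.ext_of_lintegral _ fun G hG => ?_⟩
  rw [lintegral_map hG hT, key G hG g hg hinv]
  have := key G hG (fun _ => 0) measurable_const fun _ _ => rfl
  rw [← this]
  simp

/-- The reflection in the hyperplane `⟪y, e⟫ = l`, for a unit vector `e`. -/
def planeRefl {N : ℕ} (e : Euc N) (l : ℝ) (y : Euc N) : Euc N := y - (2 * (⟪y, e⟫ - l)) • e

section planeRefl

variable {N : ℕ} {e : Euc N} {l : ℝ}

lemma inner_planeRefl (he : ‖e‖ = 1) (y : Euc N) : ⟪planeRefl e l y, e⟫ = 2 * l - ⟪y, e⟫ := by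
  rw [planeRefl, inner_sub_left, inner_smul_left, real_inner_self_eq_norm_sq, he]
  simp; ring

lemma planeRefl_planeRefl (he : ‖e‖ = 1) (y : Euc N) :
    planeRefl e l (planeRefl e l y) = y := by
  rw [planeRefl, inner_planeRefl he, planeRefl]
  module

lemma norm_planeRefl_sub (he : ‖e‖ = 1) (x y : Euc N) :
    ‖planeRefl e l x - planeRefl e l y‖ = ‖x - y‖ := by
  have h : planeRefl e l x - planeRefl e l y = (x - y) - (2 * ⟪x - y, e⟫) • e := by
    rw [planeRefl, planeRefl, inner_sub_left]; module
  rw [h, ← sq_eq_sq₀ (norm_nonneg _) (norm_nonneg _), norm_sub_sq_real, norm_smul, he,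
    inner_smul_right, mul_one, Real.norm_eq_abs, sq_abs]
  ring

lemma norm_planeRefl_sub' (he : ‖e‖ = 1) (x y : Euc N) :
    ‖planeRefl e l x - y‖ = ‖x - planeRefl e l y‖ := by
  rw [← norm_planeRefl_sub he x (planeRefl e l y), planeRefl_planeRefl he]

lemma planeRefl_eq_self {y : Euc N} (h : ⟪y, e⟫ = l) : planeRefl e l y = y := by
  simp [planeRefl, h]

lemma measurePreserving_planeRefl (he : ‖e‖ = 1) :
    MeasurePreserving (planeRefl e l : Euc N → Euc N) := by
  have h1 : MeasurePreserving ((ℝ ∙ e)ᗮ.reflection : Euc N → Euc N) :=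
    (ℝ ∙ e)ᗮ.reflection.measurePreserving
  have h2 := (measurePreserving_add_right (volume : Measure (Euc N)) ((2 * l) • e)).comp h1
  refine (funext fun y => ?_ : planeRefl e l = _) ▸ h2
  rw [Function.comp_apply, Submodule.reflection_orthogonal_apply,
    Submodule.reflection_singleton_apply, he, planeRefl, real_inner_comm]
  simp only [one_pow, RCLike.ofReal_one, div_one]
  module

end planeRefl

/-! ### Graph charts of the boundary -/

/-- The orthogonal projection to the hyperplane `ν^⊥`. -/
abbrev perp {N : ℕ} (ν : Euc N) : Euc N →L[ℝ] ((ℝ ∙ ν)ᗮ : Submodule ℝ (Euc N)) :=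
  (ℝ ∙ ν)ᗮ.orthogonalProjectionOnto

lemma perp_self {N : ℕ} (ν : Euc N) : perp ν ν = 0 :=
  (Submodule.orthogonalProjectionOnto_eq_zero_iff).2
    (Submodule.le_orthogonal_orthogonal _ (Submodule.mem_span_singleton_self ν))

lemma norm_perp_le {N : ℕ} (ν z : Euc N) : ‖perp ν z‖ ≤ ‖z‖ :=
  (ℝ ∙ ν)ᗮ.norm_orthogonalProjectionOnto_apply_le z

/-- The open cylinder of radius `r` around the line through `x₀` in direction `ν`. -/
def tube {N : ℕ} (x₀ ν : Euc N) (r : ℝ) : Set (Euc N) := {y | ‖perp ν (y - x₀)‖ < r}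

/-- Near `x₀`, the set `E` is the subgraph `⟪y, ν⟫ < f y` in direction `ν`. Instead of a function
of `N - 1` variables, `f` is a function on the whole space which is constant in direction `ν`.
Its differential `F` exists on the cylinder of radius `r`, where it is bounded, Lipschitz, and has
second differences of order `β`, all with the constant `C`. -/
structure LocalGraph {N : ℕ} (β : ℝ) (E : Set (Euc N)) (x₀ ν : Euc N) (r C : ℝ)
    (f : Euc N → ℝ) (F : Euc N → Euc N →L[ℝ] ℝ) : Prop where
  norm_normal : ‖ν‖ = 1
  radius_pos : 0 < r
  const_nonneg : 0 ≤ C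
  measurable : Measurable f
  invariant : ∀ (y : Euc N) (s : ℝ), f (y + s • ν) = f y
  hasFDerivAt : ∀ y ∈ tube x₀ ν r, HasFDerivAt f (F y) y
  norm_deriv_le : ∀ y ∈ tube x₀ ν r, ‖F y‖ ≤ C
  norm_deriv_sub_le : ∀ x ∈ tube x₀ ν r, ∀ y ∈ tube x₀ ν r, ‖F y - F x‖ ≤ C * ‖y - x‖
  norm_deriv_diff_sub_le : ∀ x ∈ tube x₀ ν r, ∀ y ∈ tube x₀ ν r, ∀ v : Euc N,
    x + v ∈ tube x₀ ν r → y + v ∈ tube x₀ ν r →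
      ‖(F (y + v) - F y) - (F (x + v) - F x)‖ ≤ C * ‖v‖ * ‖y - x‖ ^ β
  mem_iff : ∀ y ∈ Metric.ball x₀ r, y ∈ E ↔ ⟪y, ν⟫ < f y

section tube

variable {N : ℕ} {x₀ ν : Euc N} {r : ℝ}

lemma isOpen_tube : IsOpen (tube x₀ ν r) :=
  isOpen_lt ((perp ν).continuous.comp (continuous_id.sub continuous_const)).norm continuous_const

lemma convex_tube : Convex ℝ (tube x₀ ν r) := by
  intro x hx y hy a b ha hb hab
  have h : perp ν (a • x + b • y - x₀) = a • perp ν (x - x₀) + b • perp ν (y - x₀) := by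
    rw [← map_smul, ← map_smul, ← map_add]
    congr 1
    rw [smul_sub, smul_sub, sub_add_sub_comm, ← add_smul, hab, one_smul]
  have := convex_ball (0 : ((ℝ ∙ ν)ᗮ : Submodule ℝ (Euc N))) r (mem_ball_zero_iff.2 hx)
    (mem_ball_zero_iff.2 hy) ha hb hab
  rw [← h, mem_ball_zero_iff] at this
  exact this

lemma add_smul_mem_tube_iff {y : Euc N} {s : ℝ} :
    y + s • ν ∈ tube x₀ ν r ↔ y ∈ tube x₀ ν r := by
  have : perp ν (y + s • ν - x₀) = perp ν (y - x₀) := by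
    rw [add_sub_right_comm, map_add, map_smul, perp_self, smul_zero, add_zero]
  simp only [tube, Set.mem_ofPred_eq, this]

lemma add_mem_tube {y v : Euc N} {r' : ℝ} (hy : y ∈ tube x₀ ν r) (hv : ‖v‖ ≤ r') :
    y + v ∈ tube x₀ ν (r + r') := by
  have h := norm_add_le (perp ν (y - x₀)) (perp ν v)
  rw [← map_add, sub_add_eq_add_sub] at h
  have h' := norm_perp_le ν v
  simp only [tube, Set.mem_ofPred_eq] at hy ⊢
  linarith

lemma tube_mono {r' : ℝ} (h : r ≤ r') : tube x₀ ν r ⊆ tube x₀ ν r' :=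
  fun _ hy => lt_of_lt_of_le hy h

lemma ball_subset_tube : Metric.ball x₀ r ⊆ tube x₀ ν r := fun _ hy =>
  (norm_perp_le ν _).trans_lt (mem_ball_iff_norm.1 hy)

end tube

/-- On a ball, a `C^{2,β}` function has a bounded Lipschitz derivative, and the second differences
of the derivative are Hölder continuous. -/
lemma IsC2HolderOn.exists_bounds {V : Type*} [NormedAddCommGroup V] [NormedSpace ℝ V] {β : ℝ≥0}
    {h : V → ℝ} {r : ℝ} (hr : 0 < r) (hC2 : IsC2HolderOn β h (Metric.ball 0 r)) :
    ∃ C : ℝ, 0 ≤ C ∧ (∀ a ∈ Metric.ball (0 : V) r, DifferentiableAt ℝ h a) ∧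
      (∀ a ∈ Metric.ball (0 : V) r, ‖fderiv ℝ h a‖ ≤ C) ∧
      (∀ a ∈ Metric.ball (0 : V) r, ∀ b ∈ Metric.ball (0 : V) r,
        ‖fderiv ℝ h b - fderiv ℝ h a‖ ≤ C * ‖b - a‖) ∧
      ∀ a ∈ Metric.ball (0 : V) r, ∀ b ∈ Metric.ball (0 : V) r, ∀ w : V,
        a + w ∈ Metric.ball 0 r → b + w ∈ Metric.ball 0 r →
        ‖(fderiv ℝ h (b + w) - fderiv ℝ h b) - (fderiv ℝ h (a + w) - fderiv ℝ h a)‖ ≤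
          C * ‖w‖ * ‖b - a‖ ^ (β : ℝ) := by
  obtain ⟨hh, C₀, hC₀⟩ := hC2
  set B : Set V := Metric.ball 0 r with hB
  have hBo : IsOpen B := Metric.isOpen_ball
  have hBc : Convex ℝ B := convex_ball _ _
  have h0B : (0 : V) ∈ B := Metric.mem_ball_self hr
  have hd1 : ∀ a ∈ B, DifferentiableAt ℝ h a := fun a ha =>
    (hh.differentiableOn (by norm_num)).differentiableAt (hBo.mem_nhds ha)
  have hd2 : ∀ a ∈ B, DifferentiableAt ℝ (fderiv ℝ h) a := fun a ha =>
    ((hh.fderiv_of_isOpen (m := 1) hBo (by norm_num)).differentiableOn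
      (by norm_num)).differentiableAt (hBo.mem_nhds ha)
  have hhol : ∀ a ∈ B, ∀ b ∈ B, ‖fderiv ℝ (fderiv ℝ h) b - fderiv ℝ (fderiv ℝ h) a‖ ≤
      C₀ * ‖b - a‖ ^ (β : ℝ) := fun a ha b hb => by
    simpa [dist_eq_norm] using hC₀.dist_le hb ha
  set M₂ : ℝ := ‖fderiv ℝ (fderiv ℝ h) 0‖ + C₀ * r ^ (β : ℝ) with hM₂
  have hM₂0 : 0 ≤ M₂ := by positivity
  have hb2 : ∀ a ∈ B, ‖fderiv ℝ (fderiv ℝ h) a‖ ≤ M₂ := fun a ha => by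
    have h1 := hhol 0 h0B a ha
    have h2 : ‖a - 0‖ ^ (β : ℝ) ≤ r ^ (β : ℝ) := by
      rw [sub_zero]
      exact Real.rpow_le_rpow (norm_nonneg _) (mem_ball_zero_iff.1 ha).le β.2
    have h3 := norm_le_norm_add_norm_sub' (fderiv ℝ (fderiv ℝ h) a) (fderiv ℝ (fderiv ℝ h) 0)
    have h4 := mul_le_mul_of_nonneg_left h2 C₀.2
    simp only [NNReal.val_eq_coe] at h4
    linarith
  have hlip : ∀ a ∈ B, ∀ b ∈ B, ‖fderiv ℝ h b - fderiv ℝ h a‖ ≤ M₂ * ‖b - a‖ :=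
    fun a ha b hb => hBc.norm_image_sub_le_of_norm_fderiv_le hd2 hb2 ha hb
  set M₁ : ℝ := ‖fderiv ℝ h 0‖ + M₂ * r with hM₁
  have hM₁0 : 0 ≤ M₁ := by positivity
  have hb1 : ∀ a ∈ B, ‖fderiv ℝ h a‖ ≤ M₁ := fun a ha => by
    have h1 := hlip 0 h0B a ha
    have h3 := norm_le_norm_add_norm_sub' (fderiv ℝ h a) (fderiv ℝ h 0)
    have h2 := mul_le_mul_of_nonneg_left (mem_ball_zero_iff.1 ha).le hM₂0
    rw [sub_zero] at h1
    linarith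
  have hdd : ∀ a ∈ B, ∀ b ∈ B, ∀ w : V, a + w ∈ B → b + w ∈ B →
      ‖(fderiv ℝ h (b + w) - fderiv ℝ h b) - (fderiv ℝ h (a + w) - fderiv ℝ h a)‖ ≤
        C₀ * ‖w‖ * ‖b - a‖ ^ (β : ℝ) := by
    intro a ha b hb w haw hbw
    have hseg : ∀ c ∈ B, c + w ∈ B → ∀ s ∈ Set.Icc (0 : ℝ) 1, c + s • w ∈ B :=
      fun c hc hcw s hs => hBc.add_smul_mem hc hcw hs
    have hder : ∀ c ∈ B, c + w ∈ B → ∀ s ∈ Set.Icc (0 : ℝ) 1,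
        HasDerivAt (fun s : ℝ => fderiv ℝ h (c + s • w))
          (fderiv ℝ (fderiv ℝ h) (c + s • w) w) s := fun c hc hcw s hs => by
      have h1 : HasDerivAt (fun s : ℝ => c + s • w) w s := by
        simpa using ((hasDerivAt_id s).smul_const w).const_add c
      exact ((hd2 _ (hseg c hc hcw s hs)).hasFDerivAt.comp_hasDerivAt s h1)
    have := (convex_Icc (0 : ℝ) 1).norm_image_sub_le_of_norm_hasDerivWithin_le
      (f := fun s : ℝ => fderiv ℝ h (b + s • w) - fderiv ℝ h (a + s • w))
      (f' := fun s => fderiv ℝ (fderiv ℝ h) (b + s • w) w - fderiv ℝ (fderiv ℝ h) (a + s • w) w)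
      (C := C₀ * ‖w‖ * ‖b - a‖ ^ (β : ℝ)) (x := 0) (y := 1)
      (fun s hs => ((hder b hb hbw s hs).sub (hder a ha haw s hs)).hasDerivWithinAt)
      (fun s hs => ?_) (by simp) (by simp)
    · simp only [one_smul, zero_smul, add_zero, sub_zero, norm_one, mul_one] at this
      rwa [sub_sub_sub_comm] at this
    · rw [← sub_apply]
      refine (ContinuousLinearMap.le_opNorm _ _).trans ?_
      have h1 := hhol _ (hseg a ha haw s hs) _ (hseg b hb hbw s hs)
      rw [add_sub_add_right_eq_sub] at h1
      calc _ ≤ C₀ * ‖b - a‖ ^ (β : ℝ) * ‖w‖ := by gcongr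
        _ = _ := by ring
  have hC₀0 : (0 : ℝ) ≤ C₀ := C₀.2
  refine ⟨M₁ + M₂ + C₀, by positivity, hd1, fun a ha => (hb1 a ha).trans (by linarith),
    fun a ha b hb => (hlip a ha b hb).trans ?_,
    fun a ha b hb w haw hbw => (hdd a ha b hb w haw hbw).trans ?_⟩
  · gcongr; linarith
  · gcongr; linarith

lemma exists_localGraph {N : ℕ} {β : ℝ≥0} {E : Set (Euc N)} (hreg : HasC2HolderBoundary β E)
    {x₀ : Euc N} (hx₀ : x₀ ∈ frontier E) :
    ∃ ν r C f F, LocalGraph (β : ℝ) E x₀ ν r C f F := by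
  obtain ⟨ν, hν, r, hr, h, hh, hE⟩ := hreg x₀ hx₀
  set B : Set ((ℝ ∙ ν)ᗮ : Submodule ℝ (Euc N)) := Metric.ball 0 r with hB
  have hBo : IsOpen B := Metric.isOpen_ball
  obtain ⟨C, hC, hd1, hb1, hlip, hdd⟩ := hh.exists_bounds hr
  set P : Euc N →L[ℝ] ((ℝ ∙ ν)ᗮ : Submodule ℝ (Euc N)) := perp ν with hP
  have hcyl : ∀ y, y ∈ tube x₀ ν r ↔ P (y - x₀) ∈ B := fun y => by
    rw [hB, mem_ball_zero_iff]; rfl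
  have hPn : ‖P‖ ≤ 1 := ContinuousLinearMap.opNorm_le_bound _ zero_le_one fun z => by
    rw [one_mul]; exact norm_perp_le ν z
  have hcomp : ∀ T : ((ℝ ∙ ν)ᗮ : Submodule ℝ (Euc N)) →L[ℝ] ℝ, ‖T.comp P‖ ≤ ‖T‖ := fun T =>
    (T.opNorm_comp_le P).trans (mul_le_of_le_one_right (norm_nonneg _) hPn)
  have hPadd : ∀ y v, P (y + v - x₀) = P (y - x₀) + P v := fun y v => by
    rw [← map_add]; congr 1; abel
  have hPsub : ∀ x y, P (y - x₀) - P (x - x₀) = P (y - x) := fun x y => by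
    rw [← map_sub]; congr 1; abel
  set g : ((ℝ ∙ ν)ᗮ : Submodule ℝ (Euc N)) → ℝ := B.indicator h with hg
  refine ⟨ν, r, C, fun y => ⟪x₀, ν⟫ + g (P (y - x₀)),
    fun y => (fderiv ℝ h (P (y - x₀))).comp P, ⟨hν, hr, hC, ?_, ?_, ?_, ?_, ?_, ?_, ?_⟩⟩
  · have hgm : Measurable g := by
      classical
      rw [hg, ← Set.piecewise_eq_indicator]
      exact hh.1.continuousOn.measurable_piecewise continuousOn_const hBo.measurableSet
    exact (hgm.comp (P.continuous.comp (continuous_id.sub continuous_const)).measurable).const_add _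
  · intro y s
    have : P (y + s • ν - x₀) = P (y - x₀) := by
      rw [hPadd, map_smul, hP, perp_self, smul_zero, add_zero]
    simp only [this]
  · intro y hy
    have hyB := (hcyl y).1 hy
    have h1 : HasFDerivAt g (fderiv ℝ h (P (y - x₀))) (P (y - x₀)) := by
      refine (hd1 _ hyB).hasFDerivAt.congr_of_eventuallyEq ?_
      filter_upwards [hBo.mem_nhds hyB] with a ha
      exact Set.indicator_of_mem ha h
    exact (h1.comp y (P.hasFDerivAt.comp y ((hasFDerivAt_id y).sub_const x₀))).const_add _
  · intro y hy
    exact (hcomp _).trans (hb1 _ ((hcyl y).1 hy))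
  · intro x hx y hy
    rw [← ContinuousLinearMap.sub_comp]
    refine (hcomp _).trans ((hlip _ ((hcyl x).1 hx) _ ((hcyl y).1 hy)).trans ?_)
    rw [hPsub]
    gcongr
    exact norm_perp_le ν _
  · intro x hx y hy v hxv hyv
    rw [hcyl] at hx hy hxv hyv
    rw [hPadd] at hxv hyv
    rw [← ContinuousLinearMap.sub_comp, ← ContinuousLinearMap.sub_comp,
      ← ContinuousLinearMap.sub_comp, hPadd, hPadd]
    refine (hcomp _).trans ((hdd _ hx _ hy _ hxv hyv).trans ?_)
    rw [hPsub]
    gcongr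
    · exact norm_perp_le ν _
    · exact norm_perp_le ν _
  · intro y hy
    rw [hE y hy, inner_sub_left, sub_lt_iff_lt_add']
    have : P (y - x₀) ∈ B := (hcyl y).1 (ball_subset_tube hy)
    simp only [hg, Set.indicator_of_mem this]
    rfl

namespace LocalGraph

variable {N : ℕ} {β : ℝ} {E : Set (Euc N)} {x₀ ν : Euc N} {r C : ℝ} {f : Euc N → ℝ}
  {F : Euc N → Euc N →L[ℝ] ℝ}

lemma deriv_normal (H : LocalGraph β E x₀ ν r C f F) {y : Euc N} (hy : y ∈ tube x₀ ν r) :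
    F y ν = 0 := by
  have h1 : HasDerivAt (fun s : ℝ => y + s • ν) ν 0 := by
    simpa using ((hasDerivAt_id (0 : ℝ)).smul_const ν).const_add y
  have h2 : HasDerivAt (fun s : ℝ => f (y + s • ν)) (F y ν) 0 := by
    refine HasFDerivAt.comp_hasDerivAt (0 : ℝ) (l := f) ?_ h1
    simpa using H.hasFDerivAt y hy
  simp only [H.invariant] at h2
  exact h2.unique (hasDerivAt_const _ _)

lemma inner_self_normal (H : LocalGraph β E x₀ ν r C f F) : ⟪ν, ν⟫ = 1 := by
  rw [real_inner_self_eq_norm_sq, H.norm_normal, one_pow]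

lemma continuousAt (H : LocalGraph β E x₀ ν r C f F) {y : Euc N} (hy : y ∈ tube x₀ ν r) :
    ContinuousAt f y := (H.hasFDerivAt y hy).continuousAt

lemma abs_sub_le (H : LocalGraph β E x₀ ν r C f F) {x y : Euc N} (hx : x ∈ tube x₀ ν r)
    (hy : y ∈ tube x₀ ν r) : |f y - f x| ≤ C * ‖y - x‖ :=
  convex_tube.norm_image_sub_le_of_norm_hasFDerivWithin_le
    (fun z hz => (H.hasFDerivAt z hz).hasFDerivWithinAt) H.norm_deriv_le hx hy

/-- Taylor's formula with quadratic remainder. -/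
lemma abs_sub_sub_deriv_le (H : LocalGraph β E x₀ ν r C f F) {x y : Euc N}
    (hx : x ∈ tube x₀ ν r) (hy : y ∈ tube x₀ ν r) :
    |f y - f x - F x (y - x)| ≤ C * ‖y - x‖ ^ 2 := by
  have hseg : segment ℝ x y ⊆ tube x₀ ν r := convex_tube.segment_subset hx hy
  have := (convex_segment x y).norm_image_sub_le_of_norm_hasFDerivWithin_le'
    (f := f) (f' := F) (φ := F x) (C := C * ‖y - x‖)
    (fun z hz => (H.hasFDerivAt z (hseg hz)).hasFDerivWithinAt)
    (fun z hz => (H.norm_deriv_sub_le x hx z (hseg hz)).trans ?_)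
    (left_mem_segment ℝ x y) (right_mem_segment ℝ x y)
  · rw [Real.norm_eq_abs] at this
    rwa [pow_two, ← mul_assoc]
  · exact mul_le_mul_of_nonneg_left (norm_sub_le_of_mem_segment hz) H.const_nonneg

/-- The graph is the boundary. -/
lemma mem_frontier_iff (H : LocalGraph β E x₀ ν r C f F) (hE : IsOpen E) {x : Euc N}
    (hx : x ∈ Metric.ball x₀ r) : x ∈ frontier E ↔ ⟪x, ν⟫ = f x := by
  have hxc := ball_subset_tube (ν := ν) hx
  have hnhds : Metric.ball x₀ r ∈ 𝓝 x := Metric.isOpen_ball.mem_nhds hx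
  rw [hE.frontier_eq]
  constructor
  · rintro ⟨hcl, hnot⟩
    rw [H.mem_iff x hx, not_lt] at hnot
    refine le_antisymm ?_ hnot
    by_contra! hlt
    have h1 : ∀ᶠ y in 𝓝 x, f y < ⟪y, ν⟫ :=
      (H.continuousAt hxc).eventually_lt (continuous_id.inner continuous_const).continuousAt hlt
    obtain ⟨y, hyE, hy, hyb⟩ := (mem_closure_iff_frequently.1 hcl).and_eventually
      (h1.and hnhds) |>.exists
    exact lt_asymm hy ((H.mem_iff y hyb).1 hyE)
  · intro h
    refine ⟨?_, fun hxE => absurd ((H.mem_iff x hx).1 hxE) (by rw [h]; exact lt_irrefl _)⟩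
    have ht : Tendsto (fun s : ℝ => x + (-s) • ν) (𝓝[>] 0) (𝓝 x) := by
      have : Continuous fun s : ℝ => x + (-s) • ν := by fun_prop
      simpa using (this.tendsto 0).mono_left nhdsWithin_le_nhds
    refine mem_closure_of_tendsto ht ?_
    filter_upwards [ht.eventually hnhds, self_mem_nhdsWithin] with s hs hs0
    rw [H.mem_iff _ hs, H.invariant, ← h, inner_add_left, inner_smul_left, H.inner_self_normal]
    simpa using hs0

lemma inner_center (H : LocalGraph β E x₀ ν r C f F) (hE : IsOpen E) (hx₀ : x₀ ∈ frontier E) :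
    ⟪x₀, ν⟫ = f x₀ := (H.mem_frontier_iff hE (Metric.mem_ball_self H.radius_pos)).1 hx₀

end LocalGraph

/-! ### The regularised potential and its limit on the boundary -/

section tau

variable {N : ℕ} {E : Set (Euc N)}

lemma tau_of_mem {y : Euc N} (h : y ∈ E) : tau E y = 1 := by simp [tau, h]

lemma tau_of_notMem {y : Euc N} (h : y ∉ E) : tau E y = -1 := by simp [tau, h]

lemma abs_tau (y : Euc N) : |tau E y| = 1 := by
  by_cases h : y ∈ E
  · simp [tau_of_mem h]
  · simp [tau_of_notMem h]

lemma measurable_tau (hE : IsOpen E) : Measurable (tau E) :=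
  (measurable_const.indicator hE.measurableSet).sub
    (measurable_const.indicator hE.measurableSet.compl)

lemma integrable_tau_mul (hE : IsOpen E) {T : Euc N → Euc N} (hT : Measurable T) {g : Euc N → ℝ}
    (hg : Integrable g) : Integrable fun y => tau E (T y) * g y :=
  hg.bdd_mul (c := 1) ((measurable_tau hE).comp hT).aestronglyMeasurable
    (Eventually.of_forall fun _ => (abs_tau _).le)

/-- Against an even weight, only the even part of `τ_E` around `x` matters. -/
lemma integral_tau_mul_even (hE : IsOpen E) (x : Euc N) {g : Euc N → ℝ} (hg : Integrable g)
    (heven : ∀ z, g (-z) = g z) :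
    ∫ z, tau E (x + z) * g z = 1 / 2 * ∫ z, (tau E (x + z) + tau E (x - z)) * g z := by
  have h1 := integrable_tau_mul hE (T := fun z => x + z) (by fun_prop) hg
  have h2 := integrable_tau_mul hE (T := fun z => x - z) (by fun_prop) hg
  have h3 : ∫ z, tau E (x - z) * g z = ∫ z, tau E (x + z) * g z := by
    rw [← integral_neg_eq_self]
    simp only [heven, sub_neg_eq_add]
  simp_rw [add_mul]
  rw [integral_add h1 h2, h3]
  ring

end tau

/-- The potential of `τ_E` for the kernel `|x - y| ^ (-(N + α))` regularised at scale `ε`. -/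
def potential {N : ℕ} (α : ℝ) (E : Set (Euc N)) (ε : ℝ) (x : Euc N) : ℝ :=
  ∫ y, tau E y * truncKernel (N + α) ε ‖x - y‖

lemma potential_eq {N : ℕ} (α : ℝ) (E : Set (Euc N)) (ε : ℝ) (x : Euc N) :
    potential α E ε x = ∫ z, tau E (x + z) * truncKernel (N + α) ε ‖z‖ := by
  rw [potential, ← integral_add_left_eq_self _ x]
  simp

/-- Near a boundary point, `τ_E` is odd outside the region between two tangent paraboloids. -/
lemma LocalGraph.tau_add_tau_eq_zero {N : ℕ} {β : ℝ} {E : Set (Euc N)} {x₀ ν : Euc N} {r C : ℝ}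
    {f : Euc N → ℝ} {F : Euc N → Euc N →L[ℝ] ℝ} (H : LocalGraph β E x₀ ν r C f F)
    {x z : Euc N} (hx : ⟪x, ν⟫ = f x) (hxz : ‖x - x₀‖ + ‖z‖ < r)
    (hz : C * ‖z‖ ^ 2 < |⟪z, ν⟫ - F x z|) : tau E (x + z) + tau E (x - z) = 0 := by
  have hb : ∀ w : Euc N, ‖w‖ ≤ ‖z‖ → x + w ∈ Metric.ball x₀ r := fun w hw => by
    rw [mem_ball_iff_norm, add_sub_right_comm]
    exact (norm_add_le _ _).trans_lt (by linarith)
  have hxb : x ∈ Metric.ball x₀ r := by simpa using hb 0 (by simp)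
  have hpb := hb z le_rfl
  have hmb := hb (-z) (norm_neg z).le
  have h1 := H.abs_sub_sub_deriv_le (ball_subset_tube hxb) (ball_subset_tube hpb)
  have h2 := H.abs_sub_sub_deriv_le (ball_subset_tube hxb) (ball_subset_tube hmb)
  rw [add_sub_cancel_left, abs_le] at h1 h2
  rw [map_neg, norm_neg] at h2
  have i1 := H.mem_iff _ hpb
  have i2 := H.mem_iff _ hmb
  rw [inner_add_left, hx] at i1 i2
  rw [inner_neg_left] at i2
  rw [sub_eq_add_neg]
  rcases lt_abs.1 hz with h | h
  · rw [tau_of_notMem fun h' => ?_, tau_of_mem (i2.2 ?_)]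
    · norm_num
    · linarith
    · linarith [i1.1 h']
  · rw [tau_of_mem (i1.2 ?_), tau_of_notMem fun h' => ?_]
    · norm_num
    · linarith [i2.1 h']
    · linarith

lemma LocalGraph.normal_sub_deriv {N : ℕ} {β : ℝ} {E : Set (Euc N)} {x₀ ν : Euc N} {r C : ℝ}
    {f : Euc N → ℝ} {F : Euc N → Euc N →L[ℝ] ℝ} (H : LocalGraph β E x₀ ν r C f F)
    {x : Euc N} (hx : x ∈ tube x₀ ν r) : (innerSL ℝ ν - F x) ν = 1 := by
  simp [H.deriv_normal hx, H.norm_normal]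

/-- At a boundary point the even part of `τ_E` is integrable against the singular kernel. -/
lemma integrable_even_tau_mul_rpow {N : ℕ} {α : ℝ} (hα₀ : 0 < α) (hα₁ : α < 1) {β : ℝ≥0}
    {E : Set (Euc N)} (hE : IsOpen E) (hreg : HasC2HolderBoundary β E) {x : Euc N}
    (hx : x ∈ frontier E) :
    Integrable fun z : Euc N => (tau E (x + z) + tau E (x - z)) * ‖z‖ ^ (-((N : ℝ) + α)) := by
  obtain ⟨ν, r, C, f, F, H⟩ := exists_localGraph hreg hx
  obtain ⟨K, hK, hpar⟩ := lintegral_paraboloid_le N hα₀ hα₁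
  have hr := H.radius_pos
  have hxt : x ∈ tube x ν r := ball_subset_tube (Metric.mem_ball_self hr)
  set δ : ℝ := r / 2 with hδ
  have hδ0 : 0 < δ := by positivity
  set S : Set (Euc N) := {z | |(innerSL ℝ ν - F x) z| ≤ C * ‖z‖ ^ 2} ∩ Metric.closedBall 0 δ with hS
  have hSm : MeasurableSet S :=
    ((isClosed_le (innerSL ℝ ν - F x).continuous.abs (by fun_prop)).inter
      Metric.isClosed_closedBall).measurableSet
  have hpm : Measurable fun z : Euc N => ‖z‖ ^ (-((N : ℝ) + α)) :=
    measurable_norm.pow_const _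
  have i1 : Integrable (S.indicator fun z : Euc N => ‖z‖ ^ (-((N : ℝ) + α))) := by
    rw [integrable_indicator_iff hSm]
    refine ⟨hpm.aestronglyMeasurable, ?_⟩
    rw [hasFiniteIntegral_iff_ofReal
      (Eventually.of_forall fun z => Real.rpow_nonneg (norm_nonneg _) _)]
    exact (hpar _ ν C δ H.norm_normal (H.normal_sub_deriv hxt) H.const_nonneg hδ0).trans_lt
      ENNReal.ofReal_lt_top
  have i2 := integrable_truncKernel_norm (N := N) (p := N + α) (by linarith) hδ0
  have hsm : Measurable fun z => tau E (x + z) + tau E (x - z) :=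
    ((measurable_tau hE).comp (measurable_const.add measurable_id)).add
      ((measurable_tau hE).comp (measurable_const.sub measurable_id))
  refine ((i1.add i2).const_mul 2).mono' (hsm.mul hpm).aestronglyMeasurable
    (Eventually.of_forall fun z => ?_)
  have hpz : 0 ≤ ‖z‖ ^ (-((N : ℝ) + α)) := Real.rpow_nonneg (norm_nonneg _) _
  have ht2 : |tau E (x + z) + tau E (x - z)| ≤ 2 := by
    refine (abs_add_le _ _).trans ?_
    rw [abs_tau, abs_tau]; norm_num
  have hk := truncKernel_nonneg (p := N + α) (r := ‖z‖) hδ0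
  have hi : 0 ≤ S.indicator (fun z : Euc N => ‖z‖ ^ (-((N : ℝ) + α))) z :=
    Set.indicator_nonneg (fun z _ => Real.rpow_nonneg (norm_nonneg _) _) z
  rw [norm_mul, Real.norm_eq_abs, Real.norm_of_nonneg hpz, Pi.add_apply]
  rcases le_total δ ‖z‖ with hz | hz
  · rw [truncKernel_eq hz]
    refine mul_le_mul ht2 ?_ hpz (by norm_num)
    linarith
  · by_cases hzS : z ∈ S
    · rw [Set.indicator_of_mem hzS]
      refine mul_le_mul ht2 ?_ hpz (by norm_num)
      linarith
    · have : C * ‖z‖ ^ 2 < |⟪z, ν⟫ - F x z| := by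
        by_contra! h
        refine hzS ⟨?_, mem_closedBall_zero_iff.2 hz⟩
        simpa [real_inner_comm] using h
      rw [H.tau_add_tau_eq_zero (H.inner_center hE hx) (by simp; linarith) this, abs_zero, zero_mul]
      linarith

/-- The limit defining the nonlocal mean curvature exists, and it is also the limit of the
regularised potentials: after symmetrisation, both are instances of dominated convergence. -/
lemma tendsto_potential {N : ℕ} {α : ℝ} (hα₀ : 0 < α) (hα₁ : α < 1) {β : ℝ≥0}
    {E : Set (Euc N)} (hE : IsOpen E) (hreg : HasC2HolderBoundary β E) {x : Euc N}
    (hx : x ∈ frontier E) :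
    Tendsto (fun ε => potential α E ε x) (𝓝[>] 0) (𝓝 (-nonlocalMeanCurvature α E x)) := by
  set σ : Euc N → ℝ := fun z => tau E (x + z) + tau E (x - z) with hσ
  set p : ℝ := (N : ℝ) + α with hp
  have hp0 : 0 < p := by positivity
  have hNp : (N : ℝ) < p := by linarith
  have hint : Integrable fun z => σ z * ‖z‖ ^ (-p) :=
    integrable_even_tau_mul_rpow hα₀ hα₁ hE hreg hx
  have hσm : Measurable σ :=
    ((measurable_tau hE).comp (measurable_const.add measurable_id)).add
      ((measurable_tau hE).comp (measurable_const.sub measurable_id))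
  obtain ⟨ν, hν, -⟩ := hreg x hx
  have : Nontrivial (Euc N) := nontrivial_of_ne ν 0 (by rintro rfl; simp at hν)
  have hne : ∀ᵐ z : Euc N, 0 < ‖z‖ := by
    filter_upwards [compl_mem_ae_iff.2 (measure_singleton (μ := volume) (0 : Euc N))] with z hz
    exact norm_pos_iff.2 hz
  have key : ∀ g : ℝ → Euc N → ℝ, (∀ ε > 0, Integrable (g ε)) → (∀ ε > 0, ∀ z, g ε (-z) = g ε z) →
      (∀ ε > 0, ∀ z, 0 < ‖z‖ → |g ε z| ≤ ‖z‖ ^ (-p)) →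
      (∀ z, 0 < ‖z‖ → Tendsto (fun ε => g ε z) (𝓝[>] 0) (𝓝 (‖z‖ ^ (-p)))) →
      Tendsto (fun ε => ∫ z, tau E (x + z) * g ε z) (𝓝[>] 0)
        (𝓝 (1 / 2 * ∫ z, σ z * ‖z‖ ^ (-p))) := by
    intro g hgi hge hgb hgt
    have h1 : Tendsto (fun ε => ∫ z, σ z * g ε z) (𝓝[>] 0) (𝓝 (∫ z, σ z * ‖z‖ ^ (-p))) := by
      refine tendsto_integral_filter_of_dominated_convergence
        (fun z => ‖σ z * ‖z‖ ^ (-p)‖) ?_ ?_ hint.norm ?_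
      · filter_upwards [self_mem_nhdsWithin] with ε hε
        exact hσm.aestronglyMeasurable.mul (hgi ε hε).aestronglyMeasurable
      · filter_upwards [self_mem_nhdsWithin] with ε hε
        filter_upwards [hne] with z hz
        rw [norm_mul, norm_mul, Real.norm_of_nonneg (Real.rpow_nonneg hz.le _)]
        exact mul_le_mul_of_nonneg_left (hgb ε hε z hz) (norm_nonneg _)
      · filter_upwards [hne] with z hz
        exact (hgt z hz).const_mul _
    refine (h1.const_mul (1 / 2)).congr' ?_
    filter_upwards [self_mem_nhdsWithin] with ε hε
    exact (integral_tau_mul_even hE x (hgi ε hε) (hge ε hε)).symm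
  have k1 : Tendsto (fun ε => potential α E ε x) (𝓝[>] 0)
      (𝓝 (1 / 2 * ∫ z, σ z * ‖z‖ ^ (-p))) := by
    simp_rw [potential_eq]
    refine key (fun ε z => truncKernel p ε ‖z‖) (fun ε hε => integrable_truncKernel_norm hNp hε)
      (fun ε _ z => by simp only [norm_neg]) (fun ε hε z hz => ?_)
      (fun z hz => tendsto_truncKernel hz)
    rw [abs_of_nonneg (truncKernel_nonneg hε)]
    exact truncKernel_le_rpow hp0.le hz
  have k2 : Tendsto (truncatedIntegral α E x) (𝓝[>] 0)
      (𝓝 (1 / 2 * ∫ z, σ z * ‖z‖ ^ (-p))) := by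
    have hm : ∀ ε : ℝ, MeasurableSet {z : Euc N | ε ≤ ‖z‖} := fun ε =>
      (isClosed_le continuous_const continuous_norm).measurableSet
    refine (key (fun ε z => if ε ≤ ‖z‖ then ‖z‖ ^ (-p) else 0)
      (fun ε hε => ?_) (fun ε _ z => by simp only [norm_neg]) (fun ε _ z hz => ?_)
      (fun z hz => ?_)).congr fun ε => ?_
    · refine (integrable_truncKernel_norm hNp hε).mono' (Measurable.ite (hm ε)
        (measurable_norm.pow_const _) measurable_const).aestronglyMeasurable
        (Eventually.of_forall fun z => ?_)
      split_ifs with hz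
      · rw [truncKernel_eq hz, Real.norm_of_nonneg (Real.rpow_nonneg (norm_nonneg _) _)]
      · rw [norm_zero]
        exact truncKernel_nonneg hε
    · have h0 := Real.rpow_nonneg hz.le (-p)
      split_ifs
      · rw [abs_of_nonneg h0]
      · rw [abs_zero]
        exact h0
    · refine tendsto_const_nhds.congr' ?_
      filter_upwards [Ioo_mem_nhdsGT hz] with ε hε
      rw [if_pos hε.2.le]
    · have hm' : MeasurableSet {y : Euc N | ε ≤ ‖y - x‖} :=
        (isClosed_le continuous_const (by fun_prop)).measurableSet
      rw [truncatedIntegral, ← integral_indicator hm']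
      refine Eq.trans ?_ (integral_add_left_eq_self _ x)
      refine integral_congr_ae (Eventually.of_forall fun z => ?_)
      simp only [Set.indicator_apply, Set.mem_ofPred_eq, add_sub_cancel_left, sub_add_cancel_left,
        norm_neg, mul_ite, mul_zero, hp]
  have : -nonlocalMeanCurvature α E x = 1 / 2 * ∫ z, σ z * ‖z‖ ^ (-p) := by
    rw [nonlocalMeanCurvature, neg_neg, k2.limUnder_eq]
  rwa [this]

/-! ### The near part of the potential along the boundary -/

/-- A bound on a Lebesgue integral over `S` of a majorant `h` bounds the Bochner integral, with no
integrability to check. -/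
lemma abs_integral_le_of_setLIntegral_le {X : Type*} [MeasurableSpace X] {μ : Measure X}
    {g h : X → ℝ} {S : Set X} {c A : ℝ} (hS : MeasurableSet S) (hc : 0 ≤ c) (hA : 0 ≤ A)
    (hle : ∀ z ∈ S, |g z| ≤ c * h z) (hzero : ∀ z ∉ S, g z = 0)
    (hI : ∫⁻ z in S, ENNReal.ofReal (h z) ∂μ ≤ ENNReal.ofReal A) : |∫ z, g z ∂μ| ≤ c * A := by
  have h1 : ‖∫ z, g z ∂μ‖ₑ ≤ ENNReal.ofReal (c * A) := by
    calc ‖∫ z, g z ∂μ‖ₑ ≤ ∫⁻ z, ‖g z‖ₑ ∂μ := enorm_integral_le_lintegral_enorm _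
      _ = ∫⁻ z in S, ‖g z‖ₑ ∂μ := by
        refine (setLIntegral_eq_of_support_subset fun z hz => ?_).symm
        by_contra h
        exact hz (by simp [hzero z h])
      _ ≤ ∫⁻ z in S, ENNReal.ofReal c * ENNReal.ofReal (h z) ∂μ := by
        refine setLIntegral_mono' hS fun z hz => ?_
        rw [← ENNReal.ofReal_mul hc, ← ofReal_norm]
        exact ENNReal.ofReal_le_ofReal (hle z hz)
      _ = ENNReal.ofReal c * ∫⁻ z in S, ENNReal.ofReal (h z) ∂μ :=
        lintegral_const_mul' _ _ ENNReal.ofReal_ne_top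
      _ ≤ ENNReal.ofReal c * ENNReal.ofReal A := by gcongr
      _ = _ := (ENNReal.ofReal_mul hc).symm
  rw [← ofReal_norm, ENNReal.ofReal_le_ofReal_iff (by positivity)] at h1
  exact h1

lemma MeasureTheory.MeasurePreserving.integral_comp_of_measurable {X Y : Type*}
    [MeasurableSpace X] [MeasurableSpace Y] {μ : Measure X} {μ' : Measure Y} {Ψ : X → Y}
    (hΨ : MeasurePreserving Ψ μ μ') {g : Y → ℝ} (hg : Measurable g) :
    ∫ w, g (Ψ w) ∂μ = ∫ y, g y ∂μ' := by
  rw [← hΨ.map_eq, integral_map hΨ.measurable.aemeasurable hg.aestronglyMeasurable]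

lemma potential_sub_potential {N : ℕ} {α : ℝ} (hα₀ : 0 < α) {E : Set (Euc N)} (hE : IsOpen E)
    {ε δ : ℝ} (hε : 0 < ε) (hδ : 0 < δ) (x : Euc N) :
    potential α E ε x - potential α E δ x =
      ∫ y, tau E y * nearKernel (N + α) ε δ ‖x - y‖ := by
  have h : ∀ η, 0 < η → Integrable fun y => tau E y * truncKernel (N + α) η ‖x - y‖ :=
    fun η hη => integrable_tau_mul hE measurable_id (integrable_truncKernel_sub (by linarith) hη x)
  rw [potential, potential, ← integral_sub (h ε hε) (h δ hδ)]
  simp only [nearKernel, mul_sub]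

lemma integrable_nearKernel_norm {N : ℕ} {p ε δ ρ : ℝ} (hp : 0 ≤ p) (hε : 0 < ε) (hεδ : ε ≤ δ)
    {T : Euc N → Euc N} (hT : Measurable T) (hfar : ∀ z, ρ ≤ ‖z‖ → δ ≤ ‖T z‖) :
    Integrable fun z => nearKernel p ε δ ‖T z‖ := by
  have hδ : 0 < δ := hε.trans_le hεδ
  have hi : Integrable ((Metric.closedBall (0 : Euc N) ρ).indicator
      fun _ => ε ^ (-p) + δ ^ (-p)) :=
    (integrable_indicator_iff Metric.isClosed_closedBall.measurableSet).2
      (integrableOn_const measure_closedBall_lt_top.ne)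
  refine hi.mono' ((continuous_nearKernel hε hδ).measurable.comp hT.norm).aestronglyMeasurable
    (Eventually.of_forall fun z => ?_)
  by_cases hz : ‖z‖ ≤ ρ
  · rw [Set.indicator_of_mem (mem_closedBall_zero_iff.2 hz), Real.norm_eq_abs, nearKernel]
    refine (abs_sub _ _).trans ?_
    rw [abs_of_nonneg (truncKernel_nonneg hε), abs_of_nonneg (truncKernel_nonneg hδ)]
    exact add_le_add (truncKernel_le hp hε) (truncKernel_le hp hδ)
  · rw [nearKernel_eq_zero hεδ (hfar z (not_le.1 hz).le), norm_zero]
    exact Set.indicator_nonneg (fun _ _ => by positivity) z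

/-- The point of the graph of `f` on the line through `y` in direction `ν`. -/
def graphPoint {N : ℕ} (f : Euc N → ℝ) (ν y : Euc N) : Euc N := y + (f y - ⟪y, ν⟫) • ν

/-- The vertical increment `f (y + v) - f y`, set to zero outside a cylinder. -/
def graphIncrement {N : ℕ} (f : Euc N → ℝ) (x₀ ν : Euc N) (ρ : ℝ) (v y : Euc N) : ℝ :=
  (tube x₀ ν ρ).indicator (fun y => f (y + v) - f y) y

/-- The translation by the horizontal part of `v`, composed with a vertical shear so that near
`x₀` it maps the graph of `f` to itself. -/
def graphSlide {N : ℕ} (f : Euc N → ℝ) (x₀ ν : Euc N) (ρ : ℝ) (v y : Euc N) : Euc N :=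
  y + graphIncrement f x₀ ν ρ v y • ν + (v - ⟪v, ν⟫ • ν)

lemma graphSlide_add_sub {N : ℕ} (f : Euc N → ℝ) (x₀ ν : Euc N) (ρ : ℝ) (v x z : Euc N) :
    graphSlide f x₀ ν ρ v (x + z) - graphSlide f x₀ ν ρ v x =
      z + (graphIncrement f x₀ ν ρ v (x + z) - graphIncrement f x₀ ν ρ v x) • ν := by
  simp only [graphSlide]; module

namespace LocalGraph

variable {N : ℕ} {β : ℝ} {E : Set (Euc N)} {x₀ ν : Euc N} {r C : ℝ} {f : Euc N → ℝ}
  {F : Euc N → Euc N →L[ℝ] ℝ}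

lemma measurable_graphIncrement (H : LocalGraph β E x₀ ν r C f F) (ρ : ℝ) (v : Euc N) :
    Measurable (graphIncrement f x₀ ν ρ v) :=
  ((H.measurable.comp (measurable_id.add_const v)).sub H.measurable).indicator
    isOpen_tube.measurableSet

lemma measurePreserving_graphSlide (H : LocalGraph β E x₀ ν r C f F) (ρ : ℝ) (v : Euc N) :
    MeasurePreserving (graphSlide f x₀ ν ρ v) := by
  refine (measurePreserving_add_right volume (v - ⟪v, ν⟫ • ν)).comp
    (measurePreserving_shear H.norm_normal (H.measurable_graphIncrement ρ v) fun y s => ?_)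
  have hf : f (y + s • ν + v) - f (y + s • ν) = f (y + v) - f y := by
    rw [add_right_comm, H.invariant, H.invariant]
  by_cases hy : y ∈ tube x₀ ν ρ
  · rw [graphIncrement, graphIncrement, Set.indicator_of_mem hy,
      Set.indicator_of_mem (add_smul_mem_tube_iff.2 hy), hf]
  · rw [graphIncrement, graphIncrement, Set.indicator_of_notMem hy,
      Set.indicator_of_notMem (mt add_smul_mem_tube_iff.1 hy)]

lemma abs_graphIncrement_le (H : LocalGraph β E x₀ ν r C f F) {v : Euc N} (hv : ‖v‖ ≤ r / 2)
    (y : Euc N) : |graphIncrement f x₀ ν (r / 2) v y| ≤ C * ‖v‖ := by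
  by_cases hy : y ∈ tube x₀ ν (r / 2)
  · rw [graphIncrement, Set.indicator_of_mem hy]
    have h1 : y ∈ tube x₀ ν r := tube_mono (by linarith [H.radius_pos]) hy
    have h2 : y + v ∈ tube x₀ ν r := by simpa using add_mem_tube hy hv
    simpa using H.abs_sub_le h1 h2
  · rw [graphIncrement, Set.indicator_of_notMem hy, abs_zero]
    exact mul_nonneg H.const_nonneg (norm_nonneg _)

/-- The increment is differentiable with derivative `F (y + v) - F y`, so the bounds on the first
and second differences of `F` give it an affine expansion of order `1 + β`, with a constant
proportional to `‖v‖`. -/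
lemma graphIncrement_expansion (H : LocalGraph β E x₀ ν r C f F) (hβ : 0 ≤ β) {v x z : Euc N}
    (hv : ‖v‖ ≤ r / 2) (hx : x ∈ tube x₀ ν (r / 2)) (hxz : x + z ∈ tube x₀ ν (r / 2)) :
    |graphIncrement f x₀ ν (r / 2) v (x + z) - graphIncrement f x₀ ν (r / 2) v x| ≤
        C * ‖v‖ * ‖z‖ ∧
      |graphIncrement f x₀ ν (r / 2) v (x + z) - graphIncrement f x₀ ν (r / 2) v x -
        (F (x + v) - F x) z| ≤ C * ‖v‖ * ‖z‖ ^ β * ‖z‖ := by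
  have h1 : ∀ y ∈ tube x₀ ν (r / 2), y ∈ tube x₀ ν r :=
    fun y hy => tube_mono (by linarith [H.radius_pos]) hy
  have h2 : ∀ y ∈ tube x₀ ν (r / 2), y + v ∈ tube x₀ ν r :=
    fun y hy => by simpa using add_mem_tube hy hv
  rw [graphIncrement, graphIncrement, Set.indicator_of_mem hx, Set.indicator_of_mem hxz]
  have hder : ∀ y ∈ tube x₀ ν (r / 2),
      HasFDerivAt (fun y => f (y + v) - f y) (F (y + v) - F y) y := fun y hy =>
    ((hasFDerivAt_comp_add_right v).2 (H.hasFDerivAt _ (h2 y hy))).sub (H.hasFDerivAt _ (h1 y hy))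
  have hseg : segment ℝ x (x + z) ⊆ tube x₀ ν (r / 2) := convex_tube.segment_subset hx hxz
  constructor
  · have := (convex_segment x (x + z)).norm_image_sub_le_of_norm_hasFDerivWithin_le
      (C := C * ‖v‖) (fun y hy => (hder y (hseg hy)).hasFDerivWithinAt)
      (fun y hy => ?_) (left_mem_segment ℝ x _) (right_mem_segment ℝ x _)
    · simpa using this
    · have := H.norm_deriv_sub_le y (h1 y (hseg hy)) (y + v) (h2 y (hseg hy))
      rwa [add_sub_cancel_left] at this
  · have := (convex_segment x (x + z)).norm_image_sub_le_of_norm_hasFDerivWithin_le'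
      (φ := F (x + v) - F x) (C := C * ‖v‖ * ‖z‖ ^ β)
      (fun y hy => (hder y (hseg hy)).hasFDerivWithinAt)
      (fun y hy => ?_) (left_mem_segment ℝ x _) (right_mem_segment ℝ x _)
    · simpa using this
    · refine (H.norm_deriv_diff_sub_le x (h1 x hx) y (h1 y (hseg hy)) v (h2 x hx)
        (h2 y (hseg hy))).trans ?_
      have h3 := norm_sub_le_of_mem_segment hy
      rw [add_sub_cancel_left] at h3
      have := H.const_nonneg
      gcongr

lemma graphSlide_eq_graphPoint {x v : Euc N}
    (hx : x ∈ tube x₀ ν (r / 2)) (hgr : ⟪x, ν⟫ = f x) :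
    graphSlide f x₀ ν (r / 2) v x = graphPoint f ν (x + v) := by
  rw [graphSlide, graphPoint, graphIncrement, Set.indicator_of_mem hx, ← hgr, inner_add_left]
  module

lemma tau_graphSlide (H : LocalGraph β E x₀ ν r C f F) {y v : Euc N}
    (hy : y ∈ Metric.ball x₀ (r / 2))
    (hy' : graphSlide f x₀ ν (r / 2) v y ∈ Metric.ball x₀ r) :
    tau E (graphSlide f x₀ ν (r / 2) v y) = tau E y := by
  have hyt : y ∈ tube x₀ ν (r / 2) := ball_subset_tube hy
  have hyr : y ∈ Metric.ball x₀ r :=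
    Metric.ball_subset_ball (by linarith [H.radius_pos]) hy
  have hf : f (graphSlide f x₀ ν (r / 2) v y) = f (y + v) := by
    have : graphSlide f x₀ ν (r / 2) v y =
        y + v + (graphIncrement f x₀ ν (r / 2) v y - ⟪v, ν⟫) • ν := by
      rw [graphSlide]; module
    rw [this, H.invariant]
  have hin : ⟪graphSlide f x₀ ν (r / 2) v y, ν⟫ = ⟪y, ν⟫ + (f (y + v) - f y) := by
    rw [graphSlide, inner_add_left, inner_add_left, inner_sub_left, inner_smul_left,
      inner_smul_left, H.inner_self_normal, graphIncrement, Set.indicator_of_mem hyt]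
    simp
  have hiff : graphSlide f x₀ ν (r / 2) v y ∈ E ↔ y ∈ E := by
    rw [H.mem_iff _ hy', H.mem_iff _ hyr, hf, hin]
    constructor <;> intro h <;> linarith
  by_cases h : y ∈ E
  · rw [tau_of_mem h, tau_of_mem (hiff.2 h)]
  · rw [tau_of_notMem h, tau_of_notMem (mt hiff.1 h)]

/-- The near part of the potential varies slowly along the boundary: at two boundary points which
differ horizontally by `v`, the contributions of scales below `δ` differ by
`O(‖v‖ (δ^(1-α) + δ^(β-α)))`, uniformly in the regularisation `ε`. The slide `Ψ` preserves volume
and, locally, `E`, so the difference is an integral of `L(|Ψ x - Ψ y|) - L(|x - y|)`. Up to an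
error `O(‖v‖ |x - y|^(1+β))`, the displacement `Ψ x - Ψ y` is linear in `x - y`, and for a linear
displacement the difference of kernels is even, hence only sees the even part of `τ_E`. -/
lemma exists_near_estimate (H : LocalGraph β E x₀ ν r C f F) (hE : IsOpen E) (hN : 1 ≤ N)
    {α : ℝ} (hα₀ : 0 < α) (hα₁ : α < 1) (hαβ : α < β) (hβ : β ≤ 1) :
    ∃ A : ℝ, 0 ≤ A ∧ ∃ δ₀ : ℝ, 0 < δ₀ ∧ ∀ δ, 0 < δ → δ ≤ δ₀ → ∃ t₀ : ℝ, 0 < t₀ ∧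
      ∀ v : Euc N, ‖v‖ ≤ t₀ → ∀ x ∈ Metric.ball x₀ (r / 8), ⟪x, ν⟫ = f x →
        ∀ ε, 0 < ε → ε ≤ δ →
          |(potential α E ε (graphPoint f ν (x + v)) - potential α E δ (graphPoint f ν (x + v))) -
            (potential α E ε x - potential α E δ x)| ≤
            A * ‖v‖ * (δ ^ (1 - α) + δ ^ (β - α)) := by
  have hβ0 : 0 ≤ β := by linarith
  have hr := H.radius_pos
  have hC := H.const_nonneg
  obtain ⟨K₁, hK₁, hpar⟩ := lintegral_paraboloid_le N hα₀ hα₁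
  obtain ⟨K₂, hK₂, hball⟩ := lintegral_closedBall_le hN (γ := β - α) (by linarith) (by linarith)
  set p : ℝ := (N : ℝ) + α with hp
  have hp0 : 0 < p := by positivity
  set c : ℝ := 2 * p * (1 / 2) ^ (-p - 1) * C with hc
  have hc0 : 0 ≤ c := by positivity
  refine ⟨c * (C * K₁ * 2 ^ (1 - α)) + c * (K₂ * 2 ^ (β - α)), by positivity, r / 16,
    by positivity, fun δ hδ hδr => ⟨min (δ / (2 * (C + 1))) (1 / (2 * (C + 1))),
      lt_min (by positivity) (by positivity), fun v hv x hx hgr ε hε hεδ => ?_⟩⟩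
  have hv1 : ‖v‖ * (2 * (C + 1)) ≤ δ :=
    (le_div_iff₀ (by positivity)).1 (hv.trans (min_le_left _ _))
  have hv2 : ‖v‖ * (2 * (C + 1)) ≤ 1 :=
    (le_div_iff₀ (by positivity)).1 (hv.trans (min_le_right _ _))
  have hv0 : 0 ≤ ‖v‖ := norm_nonneg v
  have hCv : 0 ≤ C * ‖v‖ := by positivity
  have hvr : ‖v‖ ≤ r / 2 := by linarith
  have hCv1 : C * ‖v‖ ≤ 1 / 2 := by linarith
  set k : Euc N → ℝ := graphIncrement f x₀ ν (r / 2) v with hk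
  set Ψ : Euc N → Euc N := graphSlide f x₀ ν (r / 2) v with hΨ
  set D : Euc N →L[ℝ] ℝ := F (x + v) - F x with hD
  set L : ℝ → ℝ := nearKernel p ε δ with hL
  have hΨmp : MeasurePreserving Ψ := H.measurePreserving_graphSlide _ v
  have hkm : Measurable k := H.measurable_graphIncrement _ v
  have hxb : ∀ z : Euc N, ‖z‖ ≤ 2 * δ → x + z ∈ Metric.ball x₀ (r / 2) := fun z hz => by
    rw [mem_ball_iff_norm] at hx ⊢
    rw [add_sub_right_comm]
    exact (norm_add_le _ _).trans_lt (by linarith)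
  have hxt : x ∈ tube x₀ ν (r / 2) := by
    simpa using ball_subset_tube (hxb 0 (by simpa using hδ.le))
  have hxt' : x ∈ tube x₀ ν r := tube_mono (by linarith) hxt
  have hDn : ‖D‖ ≤ C * ‖v‖ := by
    have := H.norm_deriv_sub_le x hxt' (x + v) (by simpa using add_mem_tube hxt hvr)
    rwa [add_sub_cancel_left] at this
  have hDz : ∀ z, |D z| ≤ C * ‖v‖ * ‖z‖ := fun z =>
    (D.le_opNorm z).trans (mul_le_mul_of_nonneg_right hDn (norm_nonneg _))
  -- the three displacements: by the slide, by its linearisation, and without slide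
  set T₁ : Euc N → Euc N := fun z => z + (k (x + z) - k x) • ν with hT₁
  set T₂ : Euc N → Euc N := fun z => z + D z • ν with hT₂
  have hT₁m : Measurable T₁ := measurable_id.add
    (((hkm.comp (measurable_const.add measurable_id)).sub measurable_const).smul_const ν)
  have hT₂m : Measurable T₂ := measurable_id.add (D.measurable.smul_const ν)
  have hnorm : ∀ (z : Euc N) (a : ℝ), ‖z‖ - |a| ≤ ‖z + a • ν‖ := fun z a => by
    have := norm_sub_le (z + a • ν) (a • ν)
    rw [add_sub_cancel_right, norm_smul, H.norm_normal, mul_one, Real.norm_eq_abs] at this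
    linarith
  have hfar₁ : ∀ z, 2 * δ ≤ ‖z‖ → δ ≤ ‖T₁ z‖ := fun z hz => by
    have h1 := hnorm z (k (x + z) - k x)
    have h2 := H.abs_graphIncrement_le hvr (x + z)
    have h3 := H.abs_graphIncrement_le hvr x
    have h4 := abs_sub (k (x + z)) (k x)
    have h5 : |k (x + z) - k x| ≤ δ := by linarith
    exact le_trans (by linarith) h1
  have hfar₂ : ∀ z, 2 * δ ≤ ‖z‖ → δ ≤ ‖T₂ z‖ := fun z hz => by
    have h1 := hnorm z (D z)
    have h2 := hDz z
    have h3 := mul_le_mul_of_nonneg_right hCv1 (norm_nonneg z)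
    exact le_trans (by linarith) h1
  have hnear : ∀ z, ‖z‖ ≤ 2 * δ → |k (x + z) - k x| ≤ C * ‖v‖ * ‖z‖ ∧
      |k (x + z) - k x - D z| ≤ C * ‖v‖ * ‖z‖ ^ β * ‖z‖ := fun z hz =>
    H.graphIncrement_expansion hβ0 hvr hxt (ball_subset_tube (hxb z hz))
  have i₀ : Integrable fun z : Euc N => L ‖z‖ :=
    integrable_nearKernel_norm (ρ := 2 * δ) hp0.le hε hεδ measurable_id fun z hz =>
      le_trans (by linarith) hz
  have i₁ : Integrable fun z => L ‖T₁ z‖ := integrable_nearKernel_norm hp0.le hε hεδ hT₁m hfar₁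
  have i₂ : Integrable fun z => L ‖T₂ z‖ := integrable_nearKernel_norm hp0.le hε hεδ hT₂m hfar₂
  -- kernel differences are controlled as soon as both arguments are at least `‖z‖ / 2`
  have hLdiff : ∀ (z : Euc N) (a b s : ℝ), z ≠ 0 → |a| ≤ 1 / 2 * ‖z‖ → |b| ≤ 1 / 2 * ‖z‖ →
      |a - b| ≤ C * ‖v‖ * ‖z‖ ^ s * ‖z‖ →
      |L ‖z + a • ν‖ - L ‖z + b • ν‖| ≤ c * ‖v‖ * ‖z‖ ^ (s - p) := by
    intro z a b s hz ha hb hab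
    have hz0 : 0 < ‖z‖ := norm_pos_iff.2 hz
    have h1 := abs_nearKernel_sub_le (ε := ε) (δ := δ) hp0.le (a := 1 / 2 * ‖z‖)
      (r := ‖z + a • ν‖) (s := ‖z + b • ν‖) (by positivity) (by linarith [hnorm z a])
      (by linarith [hnorm z b])
    have h2 : |‖z + a • ν‖ - ‖z + b • ν‖| ≤ |a - b| := by
      refine (abs_norm_sub_norm_le _ _).trans_eq ?_
      rw [add_sub_add_left_eq_sub, ← sub_smul, norm_smul, H.norm_normal, mul_one,
        Real.norm_eq_abs]
    refine h1.trans ((mul_le_mul_of_nonneg_left (h2.trans hab) (by positivity)).trans_eq ?_)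
    have h3 : ‖z‖ ^ (-p - 1) * ‖z‖ ^ s * ‖z‖ = ‖z‖ ^ (s - p) := by
      rw [← Real.rpow_add hz0, ← Real.rpow_add_one hz0.ne']
      congr 1; ring
    rw [Real.mul_rpow (by norm_num) hz0.le, ← h3, hc]
    ring
  have e₁ : potential α E ε (graphPoint f ν (x + v)) - potential α E δ (graphPoint f ν (x + v)) =
      ∫ z, tau E (x + z) * L ‖T₁ z‖ := by
    rw [potential_sub_potential hα₀ hE hε hδ, ← graphSlide_eq_graphPoint hxt hgr, ← hΨ,
      ← hΨmp.integral_comp_of_measurable]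
    · refine (integral_add_left_eq_self _ x).symm.trans
        (integral_congr_ae (Eventually.of_forall fun z => ?_))
      have hTz : ‖Ψ x - Ψ (x + z)‖ = ‖T₁ z‖ := by
        rw [norm_sub_rev, hΨ, graphSlide_add_sub]
      simp only [hTz]
      rcases le_total (2 * δ) ‖z‖ with hz | hz
      · simp only [hL, nearKernel_eq_zero hεδ (hfar₁ z hz), mul_zero]
      · rw [H.tau_graphSlide (hxb z hz)]
        have h1 : Ψ (x + z) - x₀ = (x + z - x₀) + k (x + z) • ν + (v - ⟪v, ν⟫ • ν) := by
          simp only [hΨ, graphSlide, hk]; abel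
        have h2 := mem_ball_iff_norm.1 (hxb z hz)
        have h3 := H.abs_graphIncrement_le hvr (x + z)
        have h4 : |⟪v, ν⟫| ≤ ‖v‖ := by
          simpa [H.norm_normal] using abs_real_inner_le_norm v ν
        have h5 := norm_sub_le v (⟪v, ν⟫ • ν)
        have h6 := norm_add_le ((x + z - x₀) + k (x + z) • ν) (v - ⟪v, ν⟫ • ν)
        have h7 := norm_add_le (x + z - x₀) (k (x + z) • ν)
        rw [norm_smul, H.norm_normal, mul_one, Real.norm_eq_abs] at h5 h7
        rw [mem_ball_iff_norm]
        change ‖Ψ (x + z) - x₀‖ < r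
        rw [h1]
        linarith
    · exact (measurable_tau hE).mul ((continuous_nearKernel hε hδ).measurable.comp
        (measurable_const.sub measurable_id).norm)
  have e₀ : potential α E ε x - potential α E δ x = ∫ z, tau E (x + z) * L ‖z‖ := by
    rw [potential_sub_potential hα₀ hE hε hδ]
    refine (integral_add_left_eq_self _ x).symm.trans
      (integral_congr_ae (Eventually.of_forall fun z => ?_))
    simp [hL, hp]
  have hxm : Measurable fun z : Euc N => x + z := measurable_const.add measurable_id
  have split : (∫ z, tau E (x + z) * L ‖T₁ z‖) - ∫ z, tau E (x + z) * L ‖z‖ =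
      (∫ z, tau E (x + z) * (L ‖T₁ z‖ - L ‖T₂ z‖)) +
        1 / 2 * ∫ z, (tau E (x + z) + tau E (x - z)) * (L ‖T₂ z‖ - L ‖z‖) := by
    have heven : ∀ z, L ‖T₂ (-z)‖ - L ‖-z‖ = L ‖T₂ z‖ - L ‖z‖ := fun z => by
      have : T₂ (-z) = -T₂ z := by simp only [hT₂, map_neg]; module
      rw [this, norm_neg, norm_neg]
    have hsym := integral_tau_mul_even hE x (i₂.sub i₀) heven
    simp only [Pi.sub_apply] at hsym
    rw [← hsym]
    · have j₁ := integrable_tau_mul hE hxm (i₁.sub i₂)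
      have j₂ := integrable_tau_mul hE hxm (i₂.sub i₀)
      rw [← integral_sub (integrable_tau_mul hE hxm i₁) (integrable_tau_mul hE hxm i₀)]
      refine Eq.trans ?_ (integral_add j₁ j₂)
      congr 1; ext z
      ring
  have b₁ : |∫ z, tau E (x + z) * (L ‖T₁ z‖ - L ‖T₂ z‖)| ≤
      c * ‖v‖ * (K₂ * (2 * δ) ^ (β - α)) := by
    refine abs_integral_le_of_setLIntegral_le
      (S := Metric.closedBall (0 : Euc N) (2 * δ)) (h := fun z => ‖z‖ ^ (-((N : ℝ) - (β - α))))
      Metric.isClosed_closedBall.measurableSet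
      (by positivity) (by positivity) (fun z hz => ?_) (fun z hz => ?_) (hball _ (by positivity))
    · rw [abs_mul, abs_tau, one_mul]
      rw [mem_closedBall_zero_iff] at hz
      rcases eq_or_ne z 0 with rfl | hz0
      · simp only [hT₁, hT₂, add_zero, sub_self, map_zero, zero_smul, abs_zero]
        positivity
      · obtain ⟨h1, h2⟩ := hnear z hz
        have h3 := mul_le_mul_of_nonneg_right hCv1 (norm_nonneg z)
        have := hLdiff z _ _ β hz0 (h1.trans h3) ((hDz z).trans h3) h2
        rwa [show β - p = -((N : ℝ) - (β - α)) by rw [hp]; ring] at this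
    · rw [mem_closedBall_zero_iff, not_le] at hz
      simp only [hL, nearKernel_eq_zero hεδ (hfar₁ z hz.le), nearKernel_eq_zero hεδ (hfar₂ z hz.le),
        sub_self, mul_zero]
  have b₂ : |∫ z, (tau E (x + z) + tau E (x - z)) * (L ‖T₂ z‖ - L ‖z‖)| ≤
      2 * (c * ‖v‖) * (C * K₁ * (2 * δ) ^ (1 - α)) := by
    set S : Set (Euc N) := {z | |(innerSL ℝ ν - F x) z| ≤ C * ‖z‖ ^ 2} ∩
      Metric.closedBall 0 (2 * δ) with hS
    refine abs_integral_le_of_setLIntegral_le (S := S) (h := fun z => ‖z‖ ^ (-p))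
      ((isClosed_le (innerSL ℝ ν - F x).continuous.abs (by fun_prop)).inter
        Metric.isClosed_closedBall).measurableSet
      (by positivity) (by positivity) (fun z hz => ?_) (fun z hz => ?_)
      (hpar _ ν C _ H.norm_normal (H.normal_sub_deriv hxt') hC (by positivity))
    · have ht2 : |tau E (x + z) + tau E (x - z)| ≤ 2 := by
        refine (abs_add_le _ _).trans ?_
        rw [abs_tau, abs_tau]; norm_num
      rw [abs_mul, mul_assoc 2]
      refine mul_le_mul ht2 ?_ (abs_nonneg _) (by norm_num)
      rcases eq_or_ne z 0 with rfl | hz0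
      · simp only [hT₂, map_zero, zero_smul, add_zero, sub_self, abs_zero]
        positivity
      · have h3 := mul_le_mul_of_nonneg_right hCv1 (norm_nonneg z)
        have := hLdiff z (D z) 0 0 hz0 ((hDz z).trans h3) (by rw [abs_zero]; positivity)
          (by simpa using hDz z)
        simpa using this
    · rcases le_total (2 * δ) ‖z‖ with hz' | hz'
      · simp only [hL, nearKernel_eq_zero hεδ (hfar₂ z hz'),
          nearKernel_eq_zero hεδ (show δ ≤ ‖z‖ by linarith), sub_self, mul_zero]
      · have : C * ‖z‖ ^ 2 < |⟪z, ν⟫ - F x z| := by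
          by_contra! h
          refine hz ⟨?_, mem_closedBall_zero_iff.2 hz'⟩
          simpa [real_inner_comm] using h
        rw [H.tau_add_tau_eq_zero hgr (by linarith [mem_ball_iff_norm.1 hx]) this, zero_mul]
  rw [e₁, e₀, split]
  have m₁ : (2 * δ) ^ (1 - α) = 2 ^ (1 - α) * δ ^ (1 - α) :=
    Real.mul_rpow (by norm_num) hδ.le
  have m₂ : (2 * δ) ^ (β - α) = 2 ^ (β - α) * δ ^ (β - α) :=
    Real.mul_rpow (by norm_num) hδ.le
  rw [m₂] at b₁
  rw [m₁] at b₂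
  have q₁ : 0 ≤ c * (C * K₁ * 2 ^ (1 - α)) * ‖v‖ * δ ^ (β - α) := by positivity
  have q₂ : 0 ≤ c * (K₂ * 2 ^ (β - α)) * ‖v‖ * δ ^ (1 - α) := by positivity
  refine (abs_add_le _ _).trans ?_
  rw [abs_mul (1 / 2 : ℝ), abs_of_pos (by norm_num : (0 : ℝ) < 1 / 2)]
  linarith

end LocalGraph

/-! ### Differentiating the far part of the potential -/

/-- The derivative in direction `e` of `x ↦ truncKernel p δ ‖x - y‖`. On the sphere `‖x - y‖ = δ`,
where the kernel is not differentiable, the value is `0`. -/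
def kernelSlope {N : ℕ} (p δ : ℝ) (x e y : Euc N) : ℝ :=
  if δ < ‖x - y‖ then -p * (‖x - y‖ ^ 2) ^ (-p / 2 - 1) * ⟪x - y, e⟫ else 0

lemma hasFDerivAt_rpow_norm {N : ℕ} {p : ℝ} {w : Euc N} (hw : w ≠ 0) :
    HasFDerivAt (fun w : Euc N => ‖w‖ ^ (-p))
      ((-p * (‖w‖ ^ 2) ^ (-p / 2 - 1)) • innerSL ℝ w) w := by
  have h0 : ‖w‖ ^ 2 ≠ 0 := by simpa using hw
  have h1 := (hasStrictFDerivAt_norm_sq w).hasFDerivAt.rpow_const (p := -p / 2) (Or.inl h0)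
  have h2 : (fun w : Euc N => ‖w‖ ^ (-p)) = fun w => (‖w‖ ^ 2) ^ (-p / 2) := by
    ext w
    rw [← Real.rpow_natCast, ← Real.rpow_mul (norm_nonneg _)]
    congr 1; push_cast; ring
  rw [h2]
  refine h1.congr_fderiv ?_
  ext v
  simp only [smul_apply, innerSL_apply_apply, smul_eq_mul, nsmul_eq_mul]
  push_cast
  ring

/-- The regularised potential is differentiable, although its kernel is only Lipschitz: the sphere
where the kernel has a corner is a null set. -/
lemma exists_hasFDerivAt_potential {N : ℕ} [Nontrivial (Euc N)] {α : ℝ} (hα₀ : 0 < α)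
    {E : Set (Euc N)} (hE : IsOpen E) {δ : ℝ} (hδ : 0 < δ) (x : Euc N) :
    ∃ D : Euc N →L[ℝ] ℝ, HasFDerivAt (potential α E δ) D x ∧
      ∀ e, Integrable (kernelSlope (N + α) δ x e) ∧
        D e = ∫ y, tau E y * kernelSlope (N + α) δ x e y := by
  set p : ℝ := (N : ℝ) + α with hp
  have hp0 : 0 < p := by positivity
  have hNp : (N : ℝ) < p := by linarith
  set F' : Euc N → Euc N →L[ℝ] ℝ := fun y => tau E y •
    (if δ < ‖x - y‖ then (-p * (‖x - y‖ ^ 2) ^ (-p / 2 - 1)) • innerSL ℝ (x - y) else 0) with hF'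
  have hτ := measurable_tau hE
  have hxy : Measurable fun y : Euc N => x - y := measurable_const.sub measurable_id
  have hF'e : ∀ e y, F' y e = tau E y * kernelSlope p δ x e y := fun e y => by
    simp only [hF', kernelSlope]
    split_ifs
    · simp only [smul_apply, innerSL_apply_apply, smul_eq_mul]
    · simp only [smul_apply, zero_apply, smul_eq_mul]
  have hm : ∀ x : Euc N, AEStronglyMeasurable (fun y => tau E y * truncKernel p δ ‖x - y‖) :=
    fun x => (integrable_tau_mul hE measurable_id
      (integrable_truncKernel_sub hNp hδ x)).aestronglyMeasurable
  have main := hasFDerivAt_integral_of_dominated_loc_of_lip (𝕜 := ℝ)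
    (μ := (volume : Measure (Euc N)))
    (F := fun x y => tau E y * truncKernel p δ ‖x - y‖) (x₀ := x) (F' := F')
    (bound := fun y => p * 2 ^ (p + 1) * truncKernel (p + 1) δ ‖x - y‖)
    (Metric.ball_mem_nhds x (half_pos hδ)) (Eventually.of_forall hm)
    (integrable_tau_mul hE measurable_id (integrable_truncKernel_sub hNp hδ x)) ?_
    (Eventually.of_forall fun y => ?_)
    ((integrable_truncKernel_sub (by linarith) hδ x).const_mul _) ?_
  · refine ⟨_, main.2, fun e => ⟨?_, ?_⟩⟩
    · have h1 : Integrable fun y => tau E y * F' y e :=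
        integrable_tau_mul hE measurable_id (main.1.apply_continuousLinearMap e)
      refine h1.congr (Eventually.of_forall fun y => ?_)
      have : tau E y * tau E y = 1 := by
        rw [← abs_mul_abs_self, abs_tau, one_mul]
      simp only [hF'e, ← mul_assoc, this, one_mul]
    · rw [ContinuousLinearMap.integral_apply main.1]
      simp only [hF'e]
  · refine Measurable.aestronglyMeasurable (hτ.smul (Measurable.ite ?_ ?_ measurable_const))
    · exact measurableSet_lt measurable_const hxy.norm
    · exact (((hxy.norm.pow_const 2).pow_const _).const_mul _).smul
        ((innerSL ℝ).continuous.measurable.comp hxy)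
  · refine LipschitzOnWith.of_dist_le_mul fun a ha b hb => ?_
    rw [mem_ball_iff_norm] at ha hb
    set m : ℝ := max ‖x - y‖ δ / 2 with hm
    have hm0 : 0 < m := half_pos (lt_max_of_lt_right hδ)
    have hge : ∀ a : Euc N, ‖a - x‖ < δ / 2 → m ≤ max ‖a - y‖ δ := fun a ha => by
      have h1 := norm_sub_le_norm_sub_add_norm_sub x a y
      rw [norm_sub_rev] at ha
      rcases le_total ‖x - y‖ δ with h | h
      · rw [hm, max_eq_right h]; exact le_max_of_le_right (by linarith)
      · rw [hm, max_eq_left h]; exact le_max_of_le_left (by linarith)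
    have h2 := abs_truncKernel_sub_le hp0.le hm0 (hge a ha) (hge b hb)
    have h3 : |‖a - y‖ - ‖b - y‖| ≤ dist a b := by
      rw [dist_eq_norm]
      simpa using abs_norm_sub_norm_le (a - y) (b - y)
    have h4 : m ^ (-p - 1) = 2 ^ (p + 1) * truncKernel (p + 1) δ ‖x - y‖ := by
      have : (0 : ℝ) ≤ max ‖x - y‖ δ := le_max_of_le_right hδ.le
      rw [hm, Real.div_rpow this (by norm_num), truncKernel, div_eq_mul_inv, ← Real.rpow_neg
        (by norm_num), mul_comm, neg_sub_left, neg_neg, neg_add, add_comm 1 p]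
      congr 2; ring
    rw [Real.dist_eq, ← mul_sub, abs_mul, abs_tau, one_mul, Real.coe_nnabs]
    refine h2.trans ?_
    rw [h4, ← mul_assoc]
    exact mul_le_mul (le_abs_self _) h3 (abs_nonneg _) (abs_nonneg _)
  · have hns : ∀ᵐ y : Euc N, ‖x - y‖ ≠ δ := by
      filter_upwards [compl_mem_ae_iff.2 (Measure.addHaar_sphere volume x δ)] with y hy h
      exact hy (by rwa [mem_sphere_iff_norm, norm_sub_rev])
    filter_upwards [hns] with y hy
    refine HasFDerivAt.const_mul ?_ (tau E y)
    have hcont : ContinuousAt (fun a : Euc N => ‖a - y‖) x := by fun_prop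
    rcases lt_or_gt_of_ne hy with h | h
    · rw [if_neg h.not_gt]
      refine (hasFDerivAt_const (δ ^ (-p)) x).congr_of_eventuallyEq ?_
      filter_upwards [hcont.eventually_lt_const h] with a ha
      rw [truncKernel, max_eq_right ha.le]
    · rw [if_pos h]
      have hne : x - y ≠ 0 := norm_pos_iff.1 (hδ.trans h)
      have h1 := (hasFDerivAt_rpow_norm (p := p) hne).comp x ((hasFDerivAt_id x).sub_const y)
      rw [ContinuousLinearMap.comp_id] at h1
      refine h1.congr_of_eventuallyEq ?_
      filter_upwards [hcont.eventually_const_lt h] with a ha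
      rw [truncKernel_eq ha.le]
      rfl

/-! ### Reflections and one-signed integrals -/

section reflection

variable {N : ℕ} {E : Set (Euc N)} {e : Euc N} {l : ℝ}

lemma integral_tau_mul_odd (hE : IsOpen E) (he : ‖e‖ = 1) {g : Euc N → ℝ} (hg : Integrable g)
    (hgm : Measurable g) (hodd : ∀ z, g (planeRefl e l z) = -g z) :
    ∫ z, (tau E (planeRefl e l z) - tau E z) * g z = -2 * ∫ z, tau E z * g z := by
  have hR := measurePreserving_planeRefl (l := l) he
  have h1 : Integrable fun z => tau E z * g z := integrable_tau_mul hE measurable_id hg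
  have h2 := integrable_tau_mul hE hR.measurable hg
  have h3 : ∫ z, tau E (planeRefl e l z) * g z = -∫ z, tau E z * g z := by
    rw [← hR.integral_comp_of_measurable (g := fun z => tau E z * g z)
      ((measurable_tau hE).mul hgm), ← integral_neg]
    simp only [hodd, mul_neg, neg_neg]
  simp_rw [sub_mul]
  rw [integral_sub h2 h1, h3]
  ring

/-- The part of `E` beyond the hyperplane `⟪y, e⟫ = l` is reflected into `E`. -/
def ReflectsInto (E : Set (Euc N)) (e : Euc N) (l : ℝ) : Prop :=
  ∀ w ∈ E, l < ⟪w, e⟫ → planeRefl e l w ∈ E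

lemma ReflectsInto.tau_le (h : ReflectsInto E e l) {w : Euc N} (hw : l < ⟪w, e⟫) :
    tau E w ≤ tau E (planeRefl e l w) := by
  by_cases hwE : w ∈ E
  · rw [tau_of_mem hwE, tau_of_mem (h w hwE hw)]
  · rw [tau_of_notMem hwE]
    exact (abs_le.1 (abs_tau _).le).1

/-- If `g` has the sign of `⟪w, e⟫ - l`, then the antisymmetrised integrand has a sign. -/
lemma ReflectsInto.tau_sub_mul_nonneg (h : ReflectsInto E e l) (he : ‖e‖ = 1) {w : Euc N} {a : ℝ}
    (hpos : l < ⟪w, e⟫ → 0 ≤ a) (hneg : ⟪w, e⟫ < l → a ≤ 0) :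
    0 ≤ (tau E (planeRefl e l w) - tau E w) * a := by
  rcases lt_trichotomy l ⟪w, e⟫ with hw | hw | hw
  · exact mul_nonneg (sub_nonneg.2 (h.tau_le hw)) (hpos hw)
  · rw [planeRefl_eq_self hw.symm, sub_self, zero_mul]
  · refine mul_nonneg_of_nonpos_of_nonpos (sub_nonpos.2 ?_) (hneg hw)
    have := h.tau_le (w := planeRefl e l w) (by rw [inner_planeRefl he]; linarith)
    rwa [planeRefl_planeRefl he] at this

lemma norm_planeRefl_sub_sq (he : ‖e‖ = 1) (y w : Euc N) :
    ‖planeRefl e l y - w‖ ^ 2 = ‖y - w‖ ^ 2 + 4 * (⟪y, e⟫ - l) * (⟪w, e⟫ - l) := by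
  have h : planeRefl e l y - w = (y - w) - (2 * (⟪y, e⟫ - l)) • e := by rw [planeRefl]; module
  rw [h, norm_sub_sq_real, norm_smul, he, inner_smul_right, inner_sub_left, mul_one,
    Real.norm_eq_abs, sq_abs]
  ring

lemma norm_sub_le_norm_planeRefl_sub (he : ‖e‖ = 1) {y w : Euc N} (hy : l < ⟪y, e⟫)
    (hw : l ≤ ⟪w, e⟫) : ‖y - w‖ ≤ ‖planeRefl e l y - w‖ := by
  refine le_of_sq_le_sq ?_ (norm_nonneg _)
  rw [norm_planeRefl_sub_sq he]
  have := mul_nonneg (sub_nonneg.2 hy.le) (sub_nonneg.2 hw)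
  linarith

lemma norm_planeRefl_sub_le_norm_sub (he : ‖e‖ = 1) {y w : Euc N} (hy : l < ⟪y, e⟫)
    (hw : ⟪w, e⟫ ≤ l) : ‖planeRefl e l y - w‖ ≤ ‖y - w‖ := by
  refine le_of_sq_le_sq ?_ (norm_nonneg _)
  rw [norm_planeRefl_sub_sq he]
  have := mul_nonneg (sub_nonneg.2 hy.le) (sub_nonneg.2 hw)
  linarith

lemma norm_planeRefl_sub_ne (he : ‖e‖ = 1) {y w : Euc N} (hy : l < ⟪y, e⟫)
    (hw : ⟪w, e⟫ ≠ l) : ‖planeRefl e l y - w‖ ≠ ‖y - w‖ := by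
  intro h
  have h1 := norm_planeRefl_sub_sq (l := l) he y w
  rw [h, left_eq_add] at h1
  have := mul_ne_zero (sub_ne_zero.2 hy.ne') (sub_ne_zero.2 hw)
  exact this (by linarith)

variable {α c : ℝ} {β : ℝ≥0}

/-- The interior touching case: if the reflected cap touches the boundary at `planeRefl e l y`,
then comparing the curvatures at `y` and at its mirror image gives the symmetry of `E`. -/
lemma ReflectsInto.ae_symm_of_touching (h : ReflectsInto E e l) (hα₀ : 0 < α) (hα₁ : α < 1)
    (hE : IsOpen E) (hreg : HasC2HolderBoundary β E) (he : ‖e‖ = 1)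
    (hconst : ∀ x ∈ frontier E, nonlocalMeanCurvature α E x = c) {y : Euc N}
    (hy : y ∈ frontier E) (hy' : planeRefl e l y ∈ frontier E) (hly : l < ⟪y, e⟫) :
    ∀ᵐ w : Euc N, tau E (planeRefl e l w) = tau E w := by
  set p : ℝ := (N : ℝ) + α with hp
  have hp0 : 0 < p := by positivity
  have hNp : (N : ℝ) < p := by linarith
  set y' := planeRefl e l y with hy'def
  have hR := measurePreserving_planeRefl (l := l) he
  set g : ℝ → Euc N → ℝ := fun ε w => truncKernel p ε ‖y - w‖ - truncKernel p ε ‖y' - w‖ with hg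
  set u : Euc N → ℝ := fun w => tau E (planeRefl e l w) - tau E w with hu
  have hgm : ∀ ε, Measurable (g ε) := fun ε => by
    have : ∀ a : Euc N, Measurable fun w : Euc N => truncKernel p ε ‖a - w‖ := fun a =>
      (((measurable_const.sub measurable_id).norm).max measurable_const).pow_const _
    exact (this y).sub (this y')
  have hum : Measurable u := ((measurable_tau hE).comp hR.measurable).sub (measurable_tau hE)
  have hgi : ∀ ε > 0, Integrable (g ε) := fun ε hε =>
    (integrable_truncKernel_sub hNp hε y).sub (integrable_truncKernel_sub hNp hε y')
  have hodd : ∀ ε w, g ε (planeRefl e l w) = -g ε w := fun ε w => by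
    simp only [hg, hy'def]
    rw [norm_planeRefl_sub he, norm_sub_rev y, norm_planeRefl_sub' he, norm_sub_rev w]
    ring
  have hnn : ∀ ε > 0, ∀ w, 0 ≤ u w * g ε w := fun ε hε w =>
    h.tau_sub_mul_nonneg he
      (fun hw => sub_nonneg.2
        (truncKernel_antitone hp0.le hε (norm_sub_le_norm_planeRefl_sub he hly hw.le)))
      (fun hw => sub_nonpos.2
        (truncKernel_antitone hp0.le hε (norm_planeRefl_sub_le_norm_sub he hly hw.le)))
  have hlim : Tendsto (fun ε => ∫ w, u w * g ε w) (𝓝[>] 0) (𝓝 0) := by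
    have h1 := (tendsto_potential hα₀ hα₁ hE hreg hy').sub (tendsto_potential hα₀ hα₁ hE hreg hy)
    rw [hconst y hy, hconst y' hy', sub_self] at h1
    have h2 := h1.const_mul 2
    rw [mul_zero] at h2
    refine h2.congr' ?_
    filter_upwards [self_mem_nhdsWithin] with ε hε
    have h3 : potential α E ε y - potential α E ε y' = ∫ w, tau E w * g ε w := by
      have hi : ∀ a, Integrable fun w => tau E w * truncKernel p ε ‖a - w‖ := fun a =>
        integrable_tau_mul hE measurable_id (integrable_truncKernel_sub hNp hε a)
      rw [potential, potential, ← integral_sub (hi y) (hi y')]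
      simp only [hg, mul_sub, hp]
    rw [hu, integral_tau_mul_odd hE he (hgi ε hε) (hgm ε) (hodd ε), ← h3]
    ring
  have hfatou : ∫⁻ w, liminf (fun ε => ENNReal.ofReal (u w * g ε w)) (𝓝[>] 0) ≤ 0 := by
    refine (lintegral_liminf_le fun ε => (hum.mul (hgm ε)).ennreal_ofReal).trans_eq ?_
    refine Tendsto.liminf_eq ?_
    have h1 := (ENNReal.continuous_ofReal.tendsto 0).comp hlim
    rw [ENNReal.ofReal_zero] at h1
    refine h1.congr' ?_
    filter_upwards [self_mem_nhdsWithin] with ε hε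
    refine ofReal_integral_eq_lintegral_ofReal ?_ (Eventually.of_forall (hnn ε hε))
    exact ((integrable_tau_mul hE hR.measurable (hgi ε hε)).sub
      (integrable_tau_mul hE measurable_id (hgi ε hε))).congr
      (Eventually.of_forall fun w => by simp only [hu, id, Pi.sub_apply, sub_mul])
  have hptw : ∀ w, w ≠ y → w ≠ y' →
      liminf (fun ε => ENNReal.ofReal (u w * g ε w)) (𝓝[>] 0) =
        ENNReal.ofReal (u w * (‖y - w‖ ^ (-p) - ‖y' - w‖ ^ (-p))) := fun w h1 h2 => by
    refine Tendsto.liminf_eq ?_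
    refine (ENNReal.continuous_ofReal.tendsto _).comp (Tendsto.const_mul _ ?_)
    exact (tendsto_truncKernel (norm_pos_iff.2 (sub_ne_zero.2 h1.symm))).sub
      (tendsto_truncKernel (norm_pos_iff.2 (sub_ne_zero.2 h2.symm)))
  have : Nontrivial (Euc N) := nontrivial_of_ne e 0 (by rintro rfl; simp at he)
  have hsub : ∀ᵐ w : Euc N, w ≠ y ∧ w ≠ y' := by
    filter_upwards [compl_mem_ae_iff.2 (measure_singleton (μ := volume) y),
      compl_mem_ae_iff.2 (measure_singleton (μ := volume) y')] with w h1 h2 using ⟨h1, h2⟩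
  have hzero : ∀ᵐ w : Euc N, ENNReal.ofReal (u w * (‖y - w‖ ^ (-p) - ‖y' - w‖ ^ (-p))) = 0 := by
    have hm : Measurable fun w =>
        ENNReal.ofReal (u w * (‖y - w‖ ^ (-p) - ‖y' - w‖ ^ (-p))) := by
      have h0 : ∀ a : Euc N, Measurable fun w : Euc N => ‖a - w‖ ^ (-p) := fun a =>
        (measurable_const.sub measurable_id).norm.pow_const _
      exact (hum.mul ((h0 y).sub (h0 y'))).ennreal_ofReal
    refine (lintegral_eq_zero_iff hm).1 (le_antisymm (le_trans (le_of_eq ?_) hfatou) zero_le)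
    refine lintegral_congr_ae ?_
    filter_upwards [hsub] with w hw using (hptw w hw.1 hw.2).symm
  filter_upwards [hsub, hzero] with w hw hw0
  by_cases hwl : ⟪w, e⟫ = l
  · rw [planeRefl_eq_self hwl]
  have h1 : 0 < ‖y - w‖ := norm_pos_iff.2 (sub_ne_zero.2 hw.1.symm)
  have h2 : 0 < ‖y' - w‖ := norm_pos_iff.2 (sub_ne_zero.2 hw.2.symm)
  have hle : u w * (‖y - w‖ ^ (-p) - ‖y' - w‖ ^ (-p)) ≤ 0 := ENNReal.ofReal_eq_zero.1 hw0
  have hge : 0 ≤ u w * (‖y - w‖ ^ (-p) - ‖y' - w‖ ^ (-p)) :=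
    h.tau_sub_mul_nonneg he
      (fun hw => sub_nonneg.2 (Real.rpow_le_rpow_of_nonpos h1
        (norm_sub_le_norm_planeRefl_sub he hly hw.le) (by linarith)))
      (fun hw => sub_nonpos.2 (Real.rpow_le_rpow_of_nonpos h2
        (norm_planeRefl_sub_le_norm_sub he hly hw.le) (by linarith)))
  rcases mul_eq_zero.1 (le_antisymm hle hge) with h0 | h0
  · exact sub_eq_zero.1 h0
  · refine absurd ?_ (norm_planeRefl_sub_ne he hly hwl)
    exact ((Real.rpow_left_inj h1.le h2.le (neg_ne_zero.2 hp0.ne')).1 (sub_eq_zero.1 h0)).symm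

lemma LocalGraph.inner_graphPoint {β : ℝ} {x₀ ν : Euc N} {r C : ℝ} {f : Euc N → ℝ}
    {F : Euc N → Euc N →L[ℝ] ℝ} (H : LocalGraph β E x₀ ν r C f F) (y : Euc N) :
    ⟪graphPoint f ν y, ν⟫ = f (graphPoint f ν y) := by
  rw [graphPoint, H.invariant, inner_add_left, inner_smul_left, H.inner_self_normal]
  simp

lemma LocalGraph.graphPoint_add_smul {β : ℝ} {x₀ ν : Euc N} {r C : ℝ} {f : Euc N → ℝ}
    {F : Euc N → Euc N →L[ℝ] ℝ} (H : LocalGraph β E x₀ ν r C f F) (y : Euc N) (s : ℝ) :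
    graphPoint f ν (y + s • ν) = graphPoint f ν y := by
  rw [graphPoint, graphPoint, H.invariant, inner_add_left, inner_smul_left, H.inner_self_normal]
  simp only [conj_trivial]
  module

/-- The curve on the boundary above the line through `x₀` in a tangential direction `e` has
velocity `e` at `x₀`. -/
lemma LocalGraph.hasDerivAt_graphPoint {β : ℝ} {x₀ ν : Euc N} {r C : ℝ} {f : Euc N → ℝ}
    {F : Euc N → Euc N →L[ℝ] ℝ} (H : LocalGraph β E x₀ ν r C f F) (htan : ⟪e, ν⟫ = F x₀ e) :
    HasDerivAt (fun t : ℝ => graphPoint f ν (x₀ + t • e)) e 0 := by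
  have h1 : HasDerivAt (fun t : ℝ => x₀ + t • e) e 0 := by
    simpa using ((hasDerivAt_id (0 : ℝ)).smul_const e).const_add x₀
  have hx₀ : x₀ ∈ tube x₀ ν r := ball_subset_tube (Metric.mem_ball_self H.radius_pos)
  have h2 : HasDerivAt (fun t : ℝ => f (x₀ + t • e)) (F x₀ e) 0 := by
    refine HasFDerivAt.comp_hasDerivAt (0 : ℝ) (l := f) ?_ h1
    simpa using H.hasFDerivAt x₀ hx₀
  have h3 : HasDerivAt (fun t : ℝ => ⟪x₀ + t • e, ν⟫) ⟪e, ν⟫ 0 := by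
    simpa using h1.inner ℝ (hasDerivAt_const (0 : ℝ) ν)
  refine (h1.add ((h2.sub h3).smul_const ν)).congr_deriv ?_
  rw [htan, sub_self, zero_smul, add_zero]

/-- The tangential case: the critical hyperplane is orthogonal to the boundary at `x₀`. The
potential regularised at scale `δ` has at `x₀` a derivative in the tangential direction `e`, which
the near estimate bounds by a positive power of `δ`, because the full potential is constant along
the boundary. By antisymmetry this derivative is the integral of a function of constant sign, which
grows as `δ` decreases; so the integrand vanishes. -/
lemma ReflectsInto.ae_symm_of_tangent (h : ReflectsInto E e l) (hα₀ : 0 < α) (hα₁ : α < 1)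
    (hαβ : α < β) (hβ : β ≤ 1)
    (hE : IsOpen E) (hreg : HasC2HolderBoundary β E) (he : ‖e‖ = 1)
    (hconst : ∀ x ∈ frontier E, nonlocalMeanCurvature α E x = c) {x₀ ν : Euc N} {r C : ℝ}
    {f : Euc N → ℝ} {F : Euc N → Euc N →L[ℝ] ℝ} (H : LocalGraph (β : ℝ) E x₀ ν r C f F)
    (hx₀ : x₀ ∈ frontier E) (hl : ⟪x₀, e⟫ = l) (htan : ⟪e, ν⟫ = F x₀ e) :
    ∀ᵐ w : Euc N, tau E (planeRefl e l w) = tau E w := by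
  have hnt : Nontrivial (Euc N) := nontrivial_of_ne e 0 (by rintro rfl; simp at he)
  have hN : 1 ≤ N := by
    rcases Nat.eq_zero_or_pos N with rfl | h
    · exact absurd hnt (not_nontrivial _)
    · exact h
  obtain ⟨A, hA, δ₀, hδ₀, hnear⟩ := H.exists_near_estimate hE hN hα₀ hα₁ hαβ hβ
  set p : ℝ := (N : ℝ) + α with hp
  have hp0 : 0 < p := by positivity
  have hR := measurePreserving_planeRefl (l := l) he
  set γ : ℝ → Euc N := fun t => graphPoint f ν (x₀ + t • e) with hγ
  have hγ' : HasDerivAt γ e 0 := H.hasDerivAt_graphPoint htan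
  have hγ0 : γ 0 = x₀ := by
    simp only [hγ, graphPoint, zero_smul, add_zero, H.inner_center hE hx₀, sub_self]
  have hγgr : ∀ t, ⟪γ t, ν⟫ = f (γ t) := fun t => H.inner_graphPoint _
  have hslide : ∀ t : ℝ, graphPoint f ν (γ (-t) + (2 * t) • e) = γ t := by
    intro t
    have h1 : γ (-t) + (2 * t) • e =
        (x₀ + t • e) + (f (x₀ + (-t) • e) - ⟪x₀ + (-t) • e, ν⟫) • ν := by
      simp only [hγ, graphPoint]; module
    rw [h1, H.graphPoint_add_smul]
  have hlimγ : ∀ t, γ t ∈ Metric.ball x₀ (r / 8) →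
      Tendsto (fun ε => potential α E ε (γ t)) (𝓝[>] 0) (𝓝 (-c)) := fun t ht => by
    have hf : γ t ∈ frontier E := (H.mem_frontier_iff hE
      (Metric.ball_subset_ball (by linarith [H.radius_pos]) ht)).2 (hγgr t)
    have := tendsto_potential hα₀ hα₁ hE hreg hf
    rwa [hconst _ hf] at this
  -- the derivative of the far part is small
  have hsmall : ∀ δ, 0 < δ → δ ≤ δ₀ →
      |∫ y, tau E y * kernelSlope p δ x₀ e y| ≤ A * (δ ^ (1 - α) + δ ^ ((β : ℝ) - α)) := by
    intro δ hδ hδδ₀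
    obtain ⟨t₀, ht₀, hest⟩ := hnear δ hδ hδδ₀
    obtain ⟨D, hD, hDe⟩ := exists_hasFDerivAt_potential hα₀ hE hδ x₀
    rw [← (hDe e).2]
    set B : ℝ := A * (δ ^ (1 - α) + δ ^ ((β : ℝ) - α)) with hB
    have hB0 : 0 ≤ B := by positivity
    set G : ℝ → ℝ := fun t => potential α E δ (γ t) with hG
    have hball : ∀ᶠ t in 𝓝 (0 : ℝ), γ t ∈ Metric.ball x₀ (r / 8) := by
      refine hγ'.continuousAt.eventually_mem ?_
      rw [hγ0]
      exact Metric.ball_mem_nhds _ (by linarith [H.radius_pos])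
    have hneg : Tendsto (fun t : ℝ => -t) (𝓝 0) (𝓝 0) := by
      simpa using continuous_neg.tendsto (0 : ℝ)
    have hGd : HasDerivAt G (D e) 0 := by
      refine HasFDerivAt.comp_hasDerivAt (0 : ℝ) (l := potential α E δ) ?_ hγ'
      rwa [hγ0]
    have hGd' : HasDerivAt (fun t => G t - G (-t)) (2 * D e) 0 := by
      have h1 : HasDerivAt (fun t => G (-t)) (-D e) 0 := by
        have h2 : HasDerivAt G (D e) (-0) := by rwa [neg_zero]
        exact (h2.comp (0 : ℝ) (hasDerivAt_neg' (0 : ℝ))).congr_deriv (by ring)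
      exact (hGd.sub h1).congr_deriv (by ring)
    have := hGd'.le_of_lip' (C := 2 * B) (by positivity) ?_
    · rw [norm_mul, Real.norm_eq_abs, Real.norm_eq_abs, abs_two] at this
      linarith
    · have hsm : ∀ᶠ t : ℝ in 𝓝 0, ‖(2 * t) • e‖ ≤ t₀ := by
        have hc : Continuous fun t : ℝ => ‖(2 * t) • e‖ := by fun_prop
        have := hc.tendsto 0
        simp only [mul_zero, zero_smul, norm_zero] at this
        exact this.eventually_le_const ht₀
      filter_upwards [hball, hneg.eventually hball, hsm] with t h1 h2 h3
      have hle : ∀ᶠ ε in 𝓝[>] (0 : ℝ),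
          |(potential α E ε (γ t) - G t) - (potential α E ε (γ (-t)) - G (-t))| ≤
            2 * B * |t| := by
        filter_upwards [Ioc_mem_nhdsGT hδ] with ε hε
        have := hest _ h3 _ h2 (hγgr _) ε hε.1 hε.2
        rw [hslide] at this
        refine this.trans_eq ?_
        rw [norm_smul, he, Real.norm_eq_abs, abs_mul, abs_two, hB]
        ring
      have hlim := (((hlimγ t h1).sub_const (G t)).sub ((hlimγ (-t) h2).sub_const (G (-t)))).abs
      have := le_of_tendsto hlim hle
      rw [sub_sub_sub_cancel_left] at this
      simp only [neg_zero, sub_self, sub_zero, Real.norm_eq_abs]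
      rwa [abs_sub_comm]
  set u : Euc N → ℝ := fun w => tau E (planeRefl e l w) - tau E w with hu
  have hR0 : planeRefl e l x₀ = x₀ := planeRefl_eq_self hl
  have hint : ∀ δ > 0, Integrable (kernelSlope p δ x₀ e) := fun δ hδ => by
    obtain ⟨D, -, hDe⟩ := exists_hasFDerivAt_potential hα₀ hE hδ x₀
    exact (hDe e).1
  have hsm : ∀ δ, Measurable (kernelSlope p δ x₀ e) := fun δ => by
    have h1 : Measurable fun y : Euc N => x₀ - y := measurable_const.sub measurable_id
    exact Measurable.ite (measurableSet_lt measurable_const h1.norm)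
      ((((h1.norm.pow_const 2).pow_const _).const_mul _).mul
        (h1.inner measurable_const)) measurable_const
  have hui : ∀ δ > 0, Integrable fun w => u w * kernelSlope p δ x₀ e w := fun δ hδ =>
    ((integrable_tau_mul hE hR.measurable (hint δ hδ)).sub
      (integrable_tau_mul hE measurable_id (hint δ hδ))).congr
      (Eventually.of_forall fun w => by simp only [hu, id, Pi.sub_apply, sub_mul])
  have hodd : ∀ δ w, kernelSlope p δ x₀ e (planeRefl e l w) = -kernelSlope p δ x₀ e w := by
    intro δ w
    have h1 : ‖x₀ - planeRefl e l w‖ = ‖x₀ - w‖ := by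
      rw [norm_sub_rev, norm_planeRefl_sub' he, hR0, norm_sub_rev]
    have h2 : ⟪x₀ - planeRefl e l w, e⟫ = -⟪x₀ - w, e⟫ := by
      rw [inner_sub_left, inner_sub_left, inner_planeRefl he, hl]; ring
    rw [kernelSlope, kernelSlope, h1, h2]
    split_ifs <;> ring
  have hfull : ∀ w, 0 ≤ u w * (-p * (‖x₀ - w‖ ^ 2) ^ (-p / 2 - 1) * ⟪x₀ - w, e⟫) := fun w => by
    have h1 : 0 ≤ p * (‖x₀ - w‖ ^ 2) ^ (-p / 2 - 1) := by positivity
    refine h.tau_sub_mul_nonneg he (fun hw => ?_) (fun hw => ?_)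
    · have : ⟪x₀ - w, e⟫ ≤ 0 := by rw [inner_sub_left, hl]; linarith
      have := mul_nonneg_of_nonpos_of_nonpos (neg_nonpos.2 h1) this
      linarith
    · have : 0 ≤ ⟪x₀ - w, e⟫ := by rw [inner_sub_left, hl]; linarith
      have := mul_nonneg h1 this
      linarith
  have hnn : ∀ δ w, 0 ≤ u w * kernelSlope p δ x₀ e w := fun δ w => by
    rw [kernelSlope]
    split_ifs
    · exact hfull w
    · rw [mul_zero]
  have hmono : ∀ δ η w, δ ≤ η → u w * kernelSlope p η x₀ e w ≤ u w * kernelSlope p δ x₀ e w := by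
    intro δ η w hle
    by_cases hη : η < ‖x₀ - w‖
    · rw [kernelSlope, kernelSlope, if_pos hη, if_pos (hle.trans_lt hη)]
    · rw [kernelSlope, if_neg hη, mul_zero]
      exact hnn δ w
  have hzero : ∀ η > 0, ∫ w, u w * kernelSlope p η x₀ e w = 0 := by
    intro η hη
    refine le_antisymm ?_ (integral_nonneg (hnn η))
    have hlim : Tendsto (fun δ : ℝ => 2 * (A * (δ ^ (1 - α) + δ ^ ((β : ℝ) - α)))) (𝓝[>] 0)
        (𝓝 0) := by
      have hpow : ∀ s : ℝ, 0 < s → Tendsto (fun δ : ℝ => δ ^ s) (𝓝[>] 0) (𝓝 0) := fun s hs => by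
        have := (Real.continuousAt_rpow_const 0 s (Or.inr hs.le)).tendsto
        rw [Real.zero_rpow hs.ne'] at this
        exact this.mono_left nhdsWithin_le_nhds
      simpa using (((hpow _ (sub_pos.2 hα₁)).add (hpow _ (sub_pos.2 hαβ))).const_mul A).const_mul 2
    refine ge_of_tendsto hlim ?_
    filter_upwards [Ioc_mem_nhdsGT (lt_min hη hδ₀)] with δ hδ
    have h1 := hsmall δ hδ.1 (hδ.2.trans (min_le_right _ _))
    have h2 := integral_mono (hui η hη) (hui δ hδ.1)
      fun w => hmono δ η w (hδ.2.trans (min_le_left _ _))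
    have h3 : ∫ w, u w * kernelSlope p δ x₀ e w = -2 * ∫ w, tau E w * kernelSlope p δ x₀ e w :=
      integral_tau_mul_odd hE he (hint δ hδ.1) (hsm δ) (hodd δ)
    rw [h3] at h2
    have h4 := (abs_le.1 h1).1
    linarith
  have hae : ∀ᵐ w : Euc N, ∀ n : ℕ, u w * kernelSlope p (1 / ((n : ℝ) + 1)) x₀ e w = 0 := by
    rw [ae_all_iff]
    intro n
    have hn : (0 : ℝ) < 1 / ((n : ℝ) + 1) := by positivity
    exact (integral_eq_zero_iff_of_nonneg (hnn _) (hui _ hn)).1 (hzero _ hn)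
  filter_upwards [hae] with w hw
  by_cases hwl : ⟪w, e⟫ = l
  · rw [planeRefl_eq_self hwl]
  have hin : ⟪x₀ - w, e⟫ ≠ 0 := by
    rw [inner_sub_left, hl]
    exact sub_ne_zero.2 (Ne.symm hwl)
  have hpos : 0 < ‖x₀ - w‖ := norm_pos_iff.2 fun h0 => hin (by rw [h0, inner_zero_left])
  obtain ⟨n, hn⟩ := exists_nat_one_div_lt hpos
  have := hw n
  rw [kernelSlope, if_pos hn] at this
  rcases mul_eq_zero.1 this with h0 | h0
  · exact sub_eq_zero.1 h0
  · refine absurd h0 (mul_ne_zero (mul_ne_zero (neg_ne_zero.2 hp0.ne') ?_) hin)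
    exact (Real.rpow_pos_of_pos (by positivity) _).ne'

end reflection

/-! ### Moving planes -/

section movingPlanes

variable {N : ℕ} {E : Set (Euc N)} {e : Euc N} {l : ℝ}

/-- Every segment in direction `e` which starts outside `E` and ends in `E` has its midpoint at
height at most `l`, the height of `y` being `⟪y, e⟫`. Equivalently, the reflection in each
hyperplane above height `l` maps the part of `E` beyond that hyperplane into `E`. -/
def MidpointBound (E : Set (Euc N)) (e : Euc N) (l : ℝ) : Prop :=
  ∀ w ∈ E, ∀ s : ℝ, 0 < s → w - (2 * s) • e ∉ E → ⟪w, e⟫ - s ≤ l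

/-- At the critical height itself, reflection still maps into `E`, since `E` is open. -/
lemma MidpointBound.reflectsInto (h : MidpointBound E e l) (hE : IsOpen E) (he : ‖e‖ = 1) :
    ReflectsInto E e l := by
  intro w hw hlw
  by_contra hR
  have hcont : Tendsto (fun η : ℝ => w + η • e) (𝓝[>] 0) (𝓝 w) := by
    have : Continuous fun η : ℝ => w + η • e := by fun_prop
    simpa using (this.tendsto 0).mono_left nhdsWithin_le_nhds
  obtain ⟨η, hη, hη0⟩ := ((hcont.eventually (hE.mem_nhds hw)).and self_mem_nhdsWithin).exists
  have hη0 : 0 < η := hη0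
  have := h _ hη (⟪w, e⟫ - l + η / 2) (by linarith) (by
    convert hR using 2
    rw [planeRefl]; module)
  rw [inner_add_left, inner_smul_left, real_inner_self_eq_norm_sq, he] at this
  simp at this
  linarith

/-- The critical position of the moving planes. Either a segment whose midpoint has the critical
height joins two boundary points, or such segments degenerate to a boundary point `x₀`. -/
lemma exists_midpointBound (hne : E.Nonempty) (hbdd : Bornology.IsBounded E) (hE : IsOpen E)
    (he : ‖e‖ = 1) :
    ∃ l, MidpointBound E e l ∧
      ((∃ y ∈ frontier E, l < ⟪y, e⟫ ∧ planeRefl e l y ∈ frontier E) ∨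
        ∃ x₀ ∈ frontier E, ⟪x₀, e⟫ = l ∧ ∀ ρ > 0, ∃ w ∈ E, ∃ s : ℝ, 0 < s ∧
          w - (2 * s) • e ∉ E ∧ w ∈ Metric.ball x₀ ρ ∧ w - (2 * s) • e ∈ Metric.ball x₀ ρ) := by
  have hee : ⟪e, e⟫ = 1 := by rw [real_inner_self_eq_norm_sq, he, one_pow]
  obtain ⟨R, hR⟩ := hbdd.exists_norm_le
  have hin : ∀ w : Euc N, |⟪w, e⟫| ≤ ‖w‖ := fun w => by
    simpa [he] using abs_real_inner_le_norm w e
  have hinR : ∀ w ∈ E, |⟪w, e⟫| ≤ R := fun w hw => (hin w).trans (hR w hw)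
  set S : Set ℝ := {m | ∃ w ∈ E, ∃ s : ℝ, 0 < s ∧ w - (2 * s) • e ∉ E ∧ m = ⟪w, e⟫ - s} with hS
  have hSne : S.Nonempty := by
    obtain ⟨w, hw⟩ := hne
    have hR0 : 0 ≤ R := (norm_nonneg w).trans (hR w hw)
    refine ⟨_, w, hw, R + 1, by linarith, fun hz => ?_, rfl⟩
    have h1 := (abs_le.1 (hinR _ hz)).1
    have h2 := (abs_le.1 (hinR _ hw)).2
    rw [inner_sub_left, inner_smul_left, hee] at h1
    simp at h1
    linarith
  have hSb : BddAbove S := by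
    refine ⟨R, ?_⟩
    rintro _ ⟨w, hw, s, hs, -, rfl⟩
    linarith [(abs_le.1 (hinR w hw)).2]
  set l : ℝ := sSup S with hl
  have hmid : MidpointBound E e l := fun w hw s hs hz => le_csSup hSb ⟨w, hw, s, hs, hz, rfl⟩
  refine ⟨l, hmid, ?_⟩
  obtain ⟨m, -, hmlim, hmS⟩ := exists_seq_tendsto_sSup hSne hSb
  choose w hw s hs hz hm using hmS
  obtain ⟨b, hb⟩ := hmlim.bddBelow_range
  have hsb : ∀ n, s n ∈ Set.Icc 0 (R - b) := fun n => by
    have h1 := hb (Set.mem_range_self n)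
    have h2 := (abs_le.1 (hinR _ (hw n))).2
    have h3 := hm n
    exact ⟨(hs n).le, by linarith⟩
  have hcomp : IsCompact (Metric.closedBall (0 : Euc N) R ×ˢ Set.Icc (0 : ℝ) (R - b)) :=
    (isCompact_closedBall _ _).prod isCompact_Icc
  obtain ⟨⟨y, t⟩, -, φ, hφ, hlim⟩ := hcomp.tendsto_subseq (x := fun n => (w n, s n))
    fun n => ⟨mem_closedBall_zero_iff.2 (hR _ (hw n)), hsb n⟩
  have hwlim : Tendsto (fun n => w (φ n)) atTop (𝓝 y) := (continuous_fst.tendsto _).comp hlim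
  have hslim : Tendsto (fun n => s (φ n)) atTop (𝓝 t) := (continuous_snd.tendsto _).comp hlim
  have ht0 : 0 ≤ t := ge_of_tendsto' hslim fun n => (hs _).le
  have hzlim : Tendsto (fun n => w (φ n) - (2 * s (φ n)) • e) atTop (𝓝 (y - (2 * t) • e)) :=
    hwlim.sub ((hslim.const_mul 2).smul_const e)
  have hycl : y ∈ closure E := mem_closure_of_tendsto hwlim (Eventually.of_forall fun n => hw _)
  have hzE : y - (2 * t) • e ∉ E :=
    hE.isClosed_compl.mem_of_tendsto hzlim (Eventually.of_forall fun n => hz _)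
  have hyl : ⟪y, e⟫ - t = l := by
    have h1 : Tendsto (fun n => ⟪w (φ n), e⟫ - s (φ n)) atTop (𝓝 (⟪y, e⟫ - t)) :=
      (hwlim.inner tendsto_const_nhds).sub hslim
    refine tendsto_nhds_unique h1 ((hmlim.comp hφ.tendsto_atTop).congr fun n => ?_)
    exact hm _
  rw [hE.frontier_eq]
  have hshift : ∀ x : Euc N, Tendsto (fun η : ℝ => x + η • e) (𝓝[>] 0) (𝓝 x) := fun x => by
    have : Continuous fun η : ℝ => x + η • e := by fun_prop
    simpa using (this.tendsto 0).mono_left nhdsWithin_le_nhds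
  rcases ht0.eq_or_lt with rfl | ht
  · right
    simp only [mul_zero, zero_smul, sub_zero] at hzE hzlim hyl
    refine ⟨y, ⟨hycl, hzE⟩, hyl, fun ρ hρ => ?_⟩
    obtain ⟨n, h1, h2⟩ := ((hwlim.eventually (Metric.ball_mem_nhds y hρ)).and
      (hzlim.eventually (Metric.ball_mem_nhds y hρ))).exists
    exact ⟨_, hw _, _, hs _, hz _, h1, h2⟩
  · left
    have hrefl : planeRefl e l y = y - (2 * t) • e := by
      rw [planeRefl, ← hyl, sub_sub_cancel]
    -- an endpoint off the boundary could be moved in direction `e`, raising the midpoint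
    refine ⟨y, ⟨hycl, fun hyE => ?_⟩, by linarith, ?_⟩
    · obtain ⟨η, hη, hη0⟩ := (((hshift y).eventually (hE.mem_nhds hyE)).and
        self_mem_nhdsWithin).exists
      have hη0 : 0 < η := hη0
      have := hmid _ hη (t + η / 2) (by linarith) (by convert hzE using 2; module)
      rw [inner_add_left, inner_smul_left, hee] at this
      simp at this
      linarith
    · rw [hrefl]
      refine ⟨?_, hzE⟩
      by_contra hzcl
      have hopen : IsOpen (closure E)ᶜ := isClosed_closure.isOpen_compl
      obtain ⟨η, hη, hη0⟩ := (((hshift _).eventually (hopen.mem_nhds hzcl)).and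
        (Ioo_mem_nhdsGT ht)).exists
      have h1 : Tendsto (fun n => w (φ n) - (2 * (s (φ n) - η / 2)) • e) atTop
          (𝓝 (y - (2 * t) • e + η • e)) := by
        convert hzlim.add_const (η • e) using 2
        module
      have h2 : Tendsto (fun n => ⟪w (φ n), e⟫ - (s (φ n) - η / 2)) atTop (𝓝 (l + η / 2)) := by
        convert (hwlim.inner (tendsto_const_nhds (x := e))).sub (hslim.sub_const (η / 2)) using 2
        linarith
      obtain ⟨n, hn1, hn2, hn3⟩ := ((h1.eventually (hopen.mem_nhds hη)).and
        ((h2.eventually_const_lt (by linarith [hη0.1] : l < l + η / 2)).and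
          (hslim.eventually_const_lt hη0.2))).exists
      exact absurd (hmid _ (hw (φ n)) _ (by linarith [hη0.1]) fun hmem => hn1 (subset_closure hmem))
        (not_le.2 hn2)

/-- In the degenerate critical position, `e` is tangent to the boundary: otherwise `E` is near `x₀`
monotone in direction `e`, which either excludes segments entering `E` near `x₀` or produces one
whose midpoint lies too high. -/
lemma MidpointBound.tangent (h : MidpointBound E e l) (hE : IsOpen E) (he : ‖e‖ = 1) {β : ℝ}
    {x₀ ν : Euc N} {r C : ℝ} {f : Euc N → ℝ} {F : Euc N → Euc N →L[ℝ] ℝ}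
    (H : LocalGraph β E x₀ ν r C f F) (hx₀ : x₀ ∈ frontier E) (hl : ⟪x₀, e⟫ = l)
    (hdeg : ∀ ρ > 0, ∃ w ∈ E, ∃ s : ℝ, 0 < s ∧
      w - (2 * s) • e ∉ E ∧ w ∈ Metric.ball x₀ ρ ∧ w - (2 * s) • e ∈ Metric.ball x₀ ρ) :
    ⟪e, ν⟫ = F x₀ e := by
  have hee : ⟪e, e⟫ = 1 := by rw [real_inner_self_eq_norm_sq, he, one_pow]
  by_contra hne
  set a : ℝ := ⟪e, ν⟫ - F x₀ e with ha
  have ha0 : 0 < |a| := abs_pos.2 (sub_ne_zero.2 hne)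
  have hC := H.const_nonneg
  set ρ : ℝ := min r (|a| / (2 * (C + 1))) with hρ
  have hρ0 : 0 < ρ := lt_min H.radius_pos (by positivity)
  have hCρ : C * ρ ≤ |a| / 2 := by
    have h1 : ρ * (2 * (C + 1)) ≤ |a| := (le_div_iff₀ (by positivity)).1 (min_le_right _ _)
    nlinarith
  have hsub : Metric.ball x₀ ρ ⊆ Metric.ball x₀ r := Metric.ball_subset_ball (min_le_left _ _)
  have hsubt : Metric.ball x₀ ρ ⊆ tube x₀ ν r := hsub.trans ball_subset_tube
  have hmem : ∀ y ∈ Metric.ball x₀ ρ, y ∈ E ↔ ⟪y, ν⟫ < f y := fun y hy => H.mem_iff y (hsub hy)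
  have hx₀ρ : x₀ ∈ Metric.ball x₀ ρ := Metric.mem_ball_self hρ0
  -- `⟪·, ν⟫ - f` is strictly monotone in direction `e` near `x₀`
  have hslope : ∀ (y : Euc N) (s : ℝ), 0 ≤ s → y ∈ Metric.ball x₀ ρ →
      y + s • e ∈ Metric.ball x₀ ρ →
      |(⟪y + s • e, ν⟫ - f (y + s • e)) - (⟪y, ν⟫ - f y) - s * a| ≤ |a| / 2 * s := by
    intro y s hs hy hys
    have := (convex_ball x₀ ρ).norm_image_sub_le_of_norm_hasFDerivWithin_le'
      (f := f) (f' := F) (φ := F x₀) (C := C * ρ)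
      (fun z hz => (H.hasFDerivAt z (hsubt hz)).hasFDerivWithinAt)
      (fun z hz => (H.norm_deriv_sub_le x₀ (hsubt hx₀ρ) z (hsubt hz)).trans
        (mul_le_mul_of_nonneg_left (mem_ball_iff_norm.1 hz).le hC)) hy hys
    rw [add_sub_cancel_left, map_smul, norm_smul, he, mul_one, Real.norm_of_nonneg hs,
      Real.norm_eq_abs, smul_eq_mul] at this
    have h1 : (⟪y + s • e, ν⟫ - f (y + s • e)) - (⟪y, ν⟫ - f y) - s * a =
        -(f (y + s • e) - f y - s * F x₀ e) := by
      rw [inner_add_left, inner_smul_left, ha]; simp; ring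
    rw [h1, abs_neg]
    exact this.trans (mul_le_mul_of_nonneg_right hCρ hs)
  rcases lt_or_gt_of_ne (abs_pos.1 ha0) with hneg | hpos
  · -- `E` lies to the right of `x₀`
    rw [abs_of_neg hneg] at hslope
    set t : ℝ := ρ / 4 with ht
    have ht0 : 0 < t := by positivity
    have hb : ∀ s : ℝ, |s| < ρ → x₀ + s • e ∈ Metric.ball x₀ ρ := fun s hs => by
      rw [mem_ball_iff_norm, add_sub_cancel_left, norm_smul, he, mul_one]
      exact hs
    have b1 := hb (2 * t) (by rw [abs_of_pos (by positivity)]; linarith)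
    have b2 := hb (-t) (by rw [abs_neg, abs_of_pos ht0]; linarith)
    have hback : x₀ + (-t) • e + t • e = x₀ := by module
    have e1 := (abs_le.1 (hslope x₀ (2 * t) (by positivity) hx₀ρ b1)).2
    have e2 := (abs_le.1 (hslope (x₀ + (-t) • e) t ht0.le b2 (by rwa [hback]))).2
    rw [hback, H.inner_center hE hx₀] at e2
    rw [H.inner_center hE hx₀] at e1
    have hta : t * a < 0 := mul_neg_of_pos_of_neg ht0 hneg
    have m1 : x₀ + (2 * t) • e ∈ E := (hmem _ b1).2 (by linarith)
    have m2 : x₀ + (-t) • e ∉ E := fun hm => absurd ((hmem _ b2).1 hm) (by linarith)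
    have := h _ m1 (3 * t / 2) (by positivity) (by convert m2 using 2; module)
    rw [inner_add_left, inner_smul_left, hee, hl] at this
    simp at this
    linarith
  · -- `E` lies to the left of `x₀`
    rw [abs_of_pos hpos] at hslope
    obtain ⟨w, hw, s, hs, hz, hwb, hzb⟩ := hdeg ρ hρ0
    have hback : w - (2 * s) • e + (2 * s) • e = w := by module
    have e1 := (abs_le.1 (hslope _ (2 * s) (by positivity) hzb (by rwa [hback]))).1
    rw [hback] at e1
    have h1 := (hmem _ hwb).1 hw
    rw [hmem _ hzb, not_lt] at hz
    have : 0 < s * a := mul_pos hs hpos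
    linarith

/-- A set which is almost everywhere symmetric has its barycentre on the hyperplane. -/
lemma inner_barycenter (hE : IsOpen E) (hne : E.Nonempty) (hbdd : Bornology.IsBounded E)
    (he : ‖e‖ = 1) (hsymm : ∀ᵐ w : Euc N, tau E (planeRefl e l w) = tau E w) :
    ⟪(volume.real E)⁻¹ • ∫ y in E, y, e⟫ = l := by
  have hfin : volume E ≠ ⊤ := hbdd.measure_lt_top.ne
  have hpos : 0 < volume.real E := ENNReal.toReal_pos (hE.measure_pos _ hne).ne' hfin
  have hEm := hE.measurableSet
  have hR := measurePreserving_planeRefl (l := l) he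
  obtain ⟨R, hR'⟩ := hbdd.exists_norm_le
  have hid : IntegrableOn (fun y : Euc N => y) E :=
    Measure.integrableOn_of_bounded hfin measurable_id.aestronglyMeasurable (M := R)
      ((ae_restrict_iff' hEm).2 (Eventually.of_forall hR'))
  have hind : Measurable (E.indicator fun y : Euc N => ⟪y, e⟫ - l) :=
    ((continuous_id.inner continuous_const).sub continuous_const).measurable.indicator hEm
  have h1 : ∫ y, E.indicator (fun y : Euc N => ⟪y, e⟫ - l) y =
      -∫ y, E.indicator (fun y : Euc N => ⟪y, e⟫ - l) y := by
    conv_lhs => rw [← hR.integral_comp_of_measurable hind]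
    rw [← integral_neg]
    refine integral_congr_ae ?_
    filter_upwards [hsymm] with w hw
    by_cases hwE : w ∈ E
    · have : planeRefl e l w ∈ E := by
        by_contra hn
        rw [tau_of_mem hwE, tau_of_notMem hn] at hw
        norm_num at hw
      rw [Set.indicator_of_mem this, Set.indicator_of_mem hwE, inner_planeRefl he]
      ring
    · have : planeRefl e l w ∉ E := fun hn => by
        rw [tau_of_notMem hwE, tau_of_mem hn] at hw
        norm_num at hw
      rw [Set.indicator_of_notMem this, Set.indicator_of_notMem hwE, neg_zero]
  have h2 : ∫ y in E, (⟪y, e⟫ - l) = 0 := by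
    rw [← integral_indicator hEm]
    linarith
  have h3 : ∫ y in E, ⟪y, e⟫ = ⟪∫ y in E, y, e⟫ := by
    have := integral_inner (𝕜 := ℝ) hid e
    rw [real_inner_comm, ← this]
    simp only [real_inner_comm e]
  have h4 : IntegrableOn (fun y : Euc N => ⟪y, e⟫) E := hid.inner_const e
  have h5 : IntegrableOn (fun _ : Euc N => l) E := integrableOn_const hfin
  rw [integral_sub h4 h5, h3, setIntegral_const,
    smul_eq_mul] at h2
  rw [inner_smul_left]
  simp only [conj_trivial]
  rw [sub_eq_zero.1 h2, inv_mul_cancel_left₀ hpos.ne']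

end movingPlanes

/-! ### Constant nonlocal mean curvature characterises balls -/

/-- The barycentre bounds the midpoints in every direction. -/
lemma midpointBound_barycenter {N : ℕ} {α : ℝ} (hα₀ : 0 < α) (hα₁ : α < 1) {β : ℝ≥0}
    (hαβ : α < (β : ℝ)) (hβ : β ≤ 1) {E : Set (Euc N)} (hne : E.Nonempty)
    (hbdd : Bornology.IsBounded E) (hE : IsOpen E) (hreg : HasC2HolderBoundary β E) {c : ℝ}
    (hconst : ∀ x ∈ frontier E, nonlocalMeanCurvature α E x = c) {e : Euc N} (he : ‖e‖ = 1) :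
    MidpointBound E e ⟪(volume.real E)⁻¹ • ∫ y in E, y, e⟫ := by
  obtain ⟨l, hmid, hcrit⟩ := exists_midpointBound hne hbdd hE he
  have hin := hmid.reflectsInto hE he
  rw [inner_barycenter hE hne hbdd he (l := l)]
  · exact hmid
  rcases hcrit with ⟨y, hy, hly, hy'⟩ | ⟨x₀, hx₀, hl, hdeg⟩
  · exact hin.ae_symm_of_touching hα₀ hα₁ hE hreg he hconst hy hy' hly
  · obtain ⟨ν, r, C, f, F, H⟩ := exists_localGraph hreg hx₀
    exact hin.ae_symm_of_tangent hα₀ hα₁ hαβ hβ hE hreg he hconst H hx₀ hl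
      (hmid.tangent hE he H hx₀ hl hdeg)

/-- If the midpoints are bounded by one and the same point `b` in every direction, then each point
of `E` at distance `ρ` from `b` forces the whole open ball of radius `ρ` to lie in `E`. -/
lemma mem_of_midpointBound {N : ℕ} {E : Set (Euc N)} {b : Euc N}
    (h : ∀ e : Euc N, ‖e‖ = 1 → MidpointBound E e ⟪b, e⟫) {w v : Euc N} (hw : w ∈ E)
    (hv : ‖v - b‖ < ‖w - b‖) : v ∈ E := by
  by_contra hvE
  have hwv : w - v ≠ 0 := by
    rintro h0
    rw [sub_eq_zero.1 h0] at hv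
    exact lt_irrefl _ hv
  have hd : 0 < ‖w - v‖ := norm_pos_iff.2 hwv
  set e : Euc N := ‖w - v‖⁻¹ • (w - v) with hedef
  have he : ‖e‖ = 1 := norm_smul_inv_norm hwv
  have hde : ‖w - v‖ • e = w - v := by rw [hedef, smul_inv_smul₀ hd.ne']
  have h1 := h e he w hw (‖w - v‖ / 2) (by positivity) (by
    rw [mul_div_cancel₀ _ (two_ne_zero), hde, sub_sub_cancel]; exact hvE)
  have h2 : ‖w - v‖ * ⟪w - b, e⟫ = ⟪w - b, w - v⟫ := by
    rw [hedef, inner_smul_right, mul_inv_cancel_left₀ hd.ne']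
  have h3 : ‖v - b‖ ^ 2 = ‖w - b‖ ^ 2 - 2 * ⟪w - b, w - v⟫ + ‖w - v‖ ^ 2 := by
    rw [← norm_sub_sq_real]; congr 2; abel
  have h4 : ‖v - b‖ ^ 2 < ‖w - b‖ ^ 2 := by gcongr
  have h5 : ⟪w - b, e⟫ ≤ ‖w - v‖ / 2 := by rw [inner_sub_left]; linarith
  nlinarith

end

theorem theorem1p1 (N : ℕ) (α : ℝ) (hα₀ : 0 < α) (hα₁ : α < 1)
    (β : ℝ≥0) (hαβ : α < (β : ℝ)) (hβ : β ≤ 1)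
    (E : Set (EuclideanSpace ℝ (Fin N)))
    (hne : E.Nonempty) (hbdd : Bornology.IsBounded E) (hopen : IsOpen E)
    (hreg : HasC2HolderBoundary β E)
    (hconst : ∃ c : ℝ, ∀ x ∈ frontier E, nonlocalMeanCurvature α E x = c) :
    ∃ (x : EuclideanSpace ℝ (Fin N)) (r : ℝ), 0 < r ∧ E = Metric.ball x r := by
  obtain ⟨c, hc⟩ := hconst
  rcases subsingleton_or_nontrivial (Euc N) with hs | hnt
  · obtain ⟨x, hx⟩ := hne
    refine ⟨x, 1, one_pos, Set.ext fun y => ?_⟩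
    rw [Subsingleton.elim y x]
    simp [hx]
  set b : Euc N := (volume.real E)⁻¹ • ∫ y in E, y with hb
  have hmem : ∀ {w v : Euc N}, w ∈ E → ‖v - b‖ < ‖w - b‖ → v ∈ E := fun hw hv =>
    mem_of_midpointBound (fun e he =>
      midpointBound_barycenter hα₀ hα₁ hαβ hβ hne hbdd hopen hreg hc he) hw hv
  -- since `E` is open, the supremum of the distances to `b` is not attained
  have hout : ∀ w ∈ E, ∃ w' ∈ E, ‖w - b‖ < ‖w' - b‖ := by
    intro w hw
    obtain ⟨a, ha1, ha⟩ : ∃ a : Euc N, ‖a‖ = 1 ∧ ‖w - b‖ • a = w - b := by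
      by_cases h0 : w - b = 0
      · obtain ⟨a, ha⟩ := exists_norm_eq (Euc N) zero_le_one
        exact ⟨a, ha, by simp [h0]⟩
      · exact ⟨‖w - b‖⁻¹ • (w - b), norm_smul_inv_norm h0,
          smul_inv_smul₀ (norm_ne_zero_iff.2 h0) _⟩
    have hcont : Tendsto (fun η : ℝ => w + η • a) (𝓝[>] 0) (𝓝 w) := by
      have : Continuous fun η : ℝ => w + η • a := by fun_prop
      simpa using (this.tendsto 0).mono_left nhdsWithin_le_nhds
    obtain ⟨η, hη, hη0⟩ :=
      ((hcont.eventually (hopen.mem_nhds hw)).and self_mem_nhdsWithin).exists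
    have hη0 : 0 < η := hη0
    refine ⟨_, hη, ?_⟩
    have : w + η • a - b = (‖w - b‖ + η) • a := by
      rw [add_smul, ha]; abel
    rw [this, norm_smul, ha1, mul_one, Real.norm_of_nonneg (by positivity)]
    linarith
  obtain ⟨R, hR⟩ := hbdd.exists_norm_le
  have hbd : BddAbove ((fun w => ‖w - b‖) '' E) := by
    refine ⟨R + ‖b‖, ?_⟩
    rintro _ ⟨w, hw, rfl⟩
    exact (norm_sub_le _ _).trans (by linarith [hR w hw])
  have hlt : ∀ w ∈ E, ‖w - b‖ < sSup ((fun w => ‖w - b‖) '' E) := fun w hw => by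
    obtain ⟨w', hw', hww'⟩ := hout w hw
    exact hww'.trans_le (le_csSup hbd ⟨w', hw', rfl⟩)
  refine ⟨b, sSup ((fun w => ‖w - b‖) '' E), ?_, Set.ext fun v => ?_⟩
  · obtain ⟨w, hw⟩ := hne
    exact (norm_nonneg _).trans_lt (hlt w hw)
  · rw [mem_ball_iff_norm]
    refine ⟨hlt v, fun hv => ?_⟩
    obtain ⟨_, ⟨w, hw, rfl⟩, hvw⟩ := exists_lt_of_lt_csSup (hne.image _) hv
    exact hmem hw hvw
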